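/- Let $X$ be a centered log-concave real random variable, that is, $\mathbb{E}[X]=0$ and $X$ has a density $f_X$ with respect to Lebesgue measure such that $\log f_X$ is concave on the support of $f_X$ (an interval). Let $\Gamma$ be a random variable with density $g(x)=e^{-(x+1)}$ supported on $[-1,\infty)$. Write $\lVert Y\rVert_r=(\mathbb{E}|Y|^r)^{1/r}$, and let $!n=n!\sum_{k=0}^{n}\frac{(-1)^k}{k!}$ denote the subfactorial (the number of derangements of $n$ elements). Let $p,q$ be positive even integers with $p<q<100$. Then $$\frac{\lVert X\rVert_q}{\lVert X\rVert_p}\le\frac{\lVert\Gamma\rVert_q}{\lVert\Gamma\rVert_p}=\frac{(!q)^{1/q}}{(!p)^{1/p}}$$ (all the norms here being finite and positive), where equality in the inequality holds if and only if $X$ coincides in law with a nonzero real multiple of $\Gamma$, that is, if and only if $X$ coincides in law with $\pm\Gamma$ up to a positive scaling factor. -/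

import Mathlib

open MeasureTheory ProbabilityTheory

noncomputable section

/-- A real random variable `X` on `(Ω, P)` is log-concave if its law has a density `f` with respect
to Lebesgue measure such that `log f` is concave on the support of `f`. Mathlib's `ConcaveOn`
includes that the support is convex, i.e. an interval. -/
def IsLogConcave {Ω : Type*} [MeasurableSpace Ω] (X : Ω → ℝ) (P : Measure Ω) : Prop :=
  AEMeasurable X P ∧
    ∃ f : ℝ → ℝ, Measurable f ∧ (∀ x, 0 ≤ f x) ∧
      P.map X = volume.withDensity (fun x => ENNReal.ofReal (f x)) ∧
      ConcaveOn ℝ (Function.support f) (fun x => Real.log (f x))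

/-- The density `e^{-(x+1)}` on `[-1, ∞)`, extended by zero. -/
def centeredExpPDF (x : ℝ) : ℝ := if -1 ≤ x then Real.exp (-(x + 1)) else 0

/-- The law on `ℝ` with density `e^{-(x+1)}` on `[-1, ∞)`. -/
def centeredExpLaw : Measure ℝ :=
  volume.withDensity (fun x => ENNReal.ofReal (centeredExpPDF x))

end

/-! The centered exponential law has `n`-th moment `!n`, so the claim says that `(μ_n / !n)^(1/n)`,
with `μ_n` the moments of `X`, decreases along even `n`, strictly unless `X` is a multiple of `Γ`.
It is enough to go from an even `n ≥ 2` to `n + 2`: this is `IsLogConcavePDF.moment_lt_or`.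

Choose `c` with `μ_n = c^n · !n`. The proof compares the density `f` with densities `g` having the
same mass and mean. If `φ = f - g` and `H` is the double primitive of `φ`, two integrations by parts
turn `∫ t^(k+2) φ` into a positive multiple of `∫ s^k H`. For even `k` the weight `s^k` is
nonnegative, so knowing where `H` changes sign determines the sign of the next moments. Each sign
change of `H` costs sign changes of `φ`, and these are few because `f` is log-concave and `g` is
piecewise log-affine.

With `g` the exponential density of scale `c`, this gives `|μ_{n+1}| ≤ c^(n+1) · !(n+1)` (after also
reflecting `f`), with equality only for exponential laws: `odd_moment_le`, resting on
`moment_nonpos_of_not_alternatesFour`. If the inequality is strict, the intermediate value theorem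
(`exists_asymLaplaceMoment_eq`) yields a centered asymmetric Laplace law with the same moments of
orders `n` and `n + 1`; comparison with its density bounds `μ_{n+2}` by its moment:
`moment_le_asymLaplaceMoment`, resting on `moment_nonpos_of_not_alternatesFive`.

What remains is an inequality in two parameters, or one after scaling: `asymLaplaceMoment_pow_lt`.
It is strict because both scales are positive; the exponential law is the degenerate case of one
zero scale. -/

section AsymmetricLaplaceMoments

open scoped Nat

/-! ### Derangement numbers as truncated exponential sums. -/

/-- The partial sum `∑_{i ≤ n} x ^ i / i!` of the exponential series. -/
noncomputable def expPartialSum (n : ℕ) (x : ℝ) : ℝ := ∑ i ∈ Finset.range (n + 1), x ^ i / i !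

lemma expPartialSum_succ (n : ℕ) (x : ℝ) :
    expPartialSum (n + 1) x = expPartialSum n x + x ^ (n + 1) / (n + 1)! := by
  simp [expPartialSum, Finset.sum_range_succ]

lemma hasDerivAt_expPartialSum (n : ℕ) (x : ℝ) :
    HasDerivAt (expPartialSum (n + 1)) (expPartialSum n x) x := by
  induction n with
  | zero =>
    have h : expPartialSum (0 + 1) = fun x => 1 + x := by
      funext y; simp [expPartialSum, Finset.sum_range_succ]
    rw [h]
    simpa [expPartialSum] using (hasDerivAt_id x).const_add 1
  | succ n ih =>
    have h : expPartialSum (n + 1 + 1) =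
        fun y => expPartialSum (n + 1) y + y ^ (n + 1 + 1) / (n + 1 + 1)! := by
      funext y; exact expPartialSum_succ _ _
    rw [h, expPartialSum_succ n x]
    refine ih.add ?_
    have := (hasDerivAt_pow (n + 1 + 1) x).div_const ((n + 1 + 1)! : ℝ)
    refine this.congr_deriv ?_
    rw [Nat.factorial_succ (n + 1)]
    have : ((n + 1)! : ℝ) ≠ 0 := by positivity
    push_cast
    field_simp

lemma numDerangements_eq_factorial_mul (n : ℕ) :
    (numDerangements n : ℝ) = n ! * expPartialSum n (-1) := by
  have h := numDerangements_sum n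
  have h2 : (numDerangements n : ℝ) = ((numDerangements n : ℤ) : ℝ) := by simp
  rw [h2, h, expPartialSum, Finset.mul_sum]
  push_cast
  refine Finset.sum_congr rfl fun k hk => ?_
  have hk' : k ≤ n := Nat.lt_succ_iff.mp (Finset.mem_range.mp hk)
  have h3 := Nat.factorial_mul_ascFactorial k (n - k)
  rw [Nat.add_sub_cancel' hk'] at h3
  have h4 : (n ! : ℝ) = k ! * (k + 1).ascFactorial (n - k) := by exact_mod_cast h3.symm
  rw [h4]
  have : (k ! : ℝ) ≠ 0 := by positivity
  field_simp

lemma expPartialSum_neg_one_nonneg (n : ℕ) : 0 ≤ expPartialSum n (-1) := by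
  have h := numDerangements_eq_factorial_mul n
  have h1 : (0 : ℝ) < n ! := by positivity
  have h2 : (0 : ℝ) ≤ n ! * expPartialSum n (-1) := by rw [← h]; positivity
  exact nonneg_of_mul_nonneg_right h2 h1

/-- The terms alternate and decrease, so the smallest of these sums is `1 - 1 + 1/2 - 1/6 = 1/3`. -/
lemma third_le_expPartialSum_neg_one (n : ℕ) : 1 / 3 ≤ expPartialSum (n + 2) (-1) := by
  suffices H : ∀ k : ℕ, 1 / 3 ≤ expPartialSum (2 * k + 3) (-1) ∧
      1 / 3 ≤ expPartialSum (2 * k + 2) (-1) by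
    rcases Nat.even_or_odd' n with ⟨k, rfl | rfl⟩
    · exact (H k).2
    · exact (H k).1
  have hodd : ∀ k : ℕ, expPartialSum (2 * k + 3) (-1) =
      expPartialSum (2 * k + 2) (-1) - 1 / (2 * k + 3)! := by
    intro k
    rw [expPartialSum_succ, Odd.neg_one_pow ⟨k + 1, by ring⟩]; ring
  have heven : ∀ k : ℕ, expPartialSum (2 * k + 4) (-1) =
      expPartialSum (2 * k + 3) (-1) + 1 / (2 * k + 4)! := by
    intro k
    rw [expPartialSum_succ, Even.neg_one_pow ⟨k + 2, by ring⟩]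
  intro k
  induction k with
  | zero => norm_num [expPartialSum, Finset.sum_range_succ, Nat.factorial]
  | succ k ih =>
    have h1 := hodd (k + 1)
    have h2 := heven k
    rw [show 2 * (k + 1) + 3 = 2 * k + 5 by ring, show 2 * (k + 1) + 2 = 2 * k + 4 by ring] at *
    have h3 : (1 : ℝ) / (2 * k + 5)! ≤ 1 / (2 * k + 4)! := by
      apply one_div_le_one_div_of_le (by positivity)
      exact_mod_cast Nat.factorial_le (by omega)
    have h4 : (0 : ℝ) ≤ 1 / (2 * k + 4)! := by positivity
    constructor <;> linarith [ih.1]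

lemma numDerangements_pos_of_two_le {n : ℕ} (hn : 2 ≤ n) : (0 : ℝ) < numDerangements n := by
  obtain ⟨k, rfl⟩ := Nat.exists_eq_add_of_le' hn
  rw [numDerangements_eq_factorial_mul]
  have := third_le_expPartialSum_neg_one k
  positivity

lemma le_of_hasDerivAt_le {F G F' G' : ℝ → ℝ} (hF : ∀ x, HasDerivAt F (F' x) x)
    (hG : ∀ x, HasDerivAt G (G' x) x) (h0 : G 0 ≤ F 0) (h : ∀ x, 0 ≤ x → G' x ≤ F' x)
    {x : ℝ} (hx : 0 ≤ x) : G x ≤ F x := by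
  have hd : ∀ y, HasDerivAt (fun y => F y - G y) (F' y - G' y) y := fun y => (hF y).sub (hG y)
  have hm : MonotoneOn (fun y => F y - G y) (Set.Ici 0) := by
    apply monotoneOn_of_deriv_nonneg (convex_Ici 0)
    · exact fun y _ => (hd y).continuousAt.continuousWithinAt
    · exact fun y _ => (hd y).differentiableAt.differentiableWithinAt
    · intro y hy
      rw [(hd y).deriv]
      rw [interior_Ici] at hy
      have := h y (le_of_lt hy)
      linarith
  have := hm (Set.self_mem_Ici) hx hx
  simp only at this
  linarith

lemma hasDerivAt_expPartialSum_sub_one (n : ℕ) (r : ℝ) :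
    HasDerivAt (fun r => expPartialSum (n + 1) (r - 1)) (expPartialSum n (r - 1)) r := by
  have := (hasDerivAt_expPartialSum n (r - 1)).comp r ((hasDerivAt_id r).sub_const 1)
  exact this.congr_deriv (mul_one _)

/-- In the Taylor expansion of `expPartialSum n (r - 1)` at `r = 0` the coefficient of `r^j` is
`expPartialSum (n - j) (-1) / j!`, which is nonnegative because it counts derangements. This lemma
and the next two truncate that expansion, each following from the previous one by integration. -/
lemma expPartialSum_zeroth_le (n : ℕ) {r : ℝ} (hr : 0 ≤ r) :
    expPartialSum n (-1) ≤ expPartialSum n (r - 1) := by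
  induction n generalizing r with
  | zero => simp [expPartialSum]
  | succ n ih =>
    exact le_of_hasDerivAt_le (hasDerivAt_expPartialSum_sub_one n) (G' := fun _ => 0)
      (fun x => hasDerivAt_const x _) (by simp)
      (fun x hx => (expPartialSum_neg_one_nonneg n).trans (ih hx)) hr

lemma expPartialSum_first_le (n : ℕ) {r : ℝ} (hr : 0 ≤ r) :
    expPartialSum (n + 1) (-1) + r * expPartialSum n (-1) ≤ expPartialSum (n + 1) (r - 1) := by
  refine le_of_hasDerivAt_le (G := fun r => expPartialSum (n + 1) (-1) + r * expPartialSum n (-1))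
    (hasDerivAt_expPartialSum_sub_one n) (G' := fun _ => expPartialSum n (-1))
    (fun x => ?_) (by simp) (fun x hx => expPartialSum_zeroth_le n hx) hr
  simpa using ((hasDerivAt_id x).mul_const (expPartialSum n (-1))).const_add
    (expPartialSum (n + 1) (-1))

lemma expPartialSum_second_le (n : ℕ) {r : ℝ} (hr : 0 ≤ r) :
    expPartialSum (n + 2) (-1) + r * expPartialSum (n + 1) (-1) + r ^ 2 / 2 * expPartialSum n (-1)
      ≤ expPartialSum (n + 2) (r - 1) := by
  refine le_of_hasDerivAt_le (G := fun r => expPartialSum (n + 2) (-1) +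
      r * expPartialSum (n + 1) (-1) + r ^ 2 / 2 * expPartialSum n (-1))
    (hasDerivAt_expPartialSum_sub_one (n + 1))
    (G' := fun r => expPartialSum (n + 1) (-1) + r * expPartialSum n (-1))
    (fun x => ?_) (by simp) (fun x hx => expPartialSum_first_le n hx) hr
  have h1 := ((hasDerivAt_id x).mul_const (expPartialSum (n + 1) (-1))).const_add
    (expPartialSum (n + 2) (-1))
  have h2 := (((hasDerivAt_pow 2 x).div_const 2).mul_const (expPartialSum n (-1)))
  exact (h1.add h2).congr_deriv (by simp)

/-! ### Moment inequality for asymmetric Laplace laws. -/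

/-- The `k`-th moment of the centered asymmetric Laplace law with scales `a` and `b`. -/
noncomputable def asymLaplaceMoment (k : ℕ) (a b : ℝ) : ℝ :=
  k ! * (∑ i ∈ Finset.range (k + 1),
    (b - a) ^ i / i ! * (a ^ (k + 1 - i) - (-b) ^ (k + 1 - i))) / (a + b)

lemma asymLaplaceMoment_mul {c : ℝ} (hc : c ≠ 0) (k : ℕ) (a b : ℝ) :
    asymLaplaceMoment k (c * a) (c * b) = c ^ k * asymLaplaceMoment k a b := by
  unfold asymLaplaceMoment
  have h : ∑ i ∈ Finset.range (k + 1), (c * b - c * a) ^ i / i ! *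
      ((c * a) ^ (k + 1 - i) - (-(c * b)) ^ (k + 1 - i)) = c ^ (k + 1) *
      ∑ i ∈ Finset.range (k + 1), (b - a) ^ i / i ! * (a ^ (k + 1 - i) - (-b) ^ (k + 1 - i)) := by
    rw [Finset.mul_sum]
    refine Finset.sum_congr rfl fun i hi => ?_
    have hi' : i ≤ k + 1 := (Finset.mem_range.mp hi).le
    have h1 : c ^ (k + 1) = c ^ i * c ^ (k + 1 - i) := by rw [← pow_add]; congr 1; omega
    rw [h1, ← mul_sub, mul_pow, mul_pow, show -(c * b) = c * (-b) by ring, mul_pow]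
    ring
  rw [h, ← mul_add, pow_succ]
  rcases eq_or_ne (a + b) 0 with h0 | h0
  · simp [h0]
  · field_simp

lemma asymLaplaceMoment_swap (k : ℕ) (a b : ℝ) :
    asymLaplaceMoment k b a = (-1) ^ k * asymLaplaceMoment k a b := by
  unfold asymLaplaceMoment
  rw [add_comm b a, ← mul_div_assoc, mul_left_comm]
  congr 2
  rw [Finset.mul_sum]
  refine Finset.sum_congr rfl fun i hi => ?_
  have hi' : i ≤ k := Nat.lt_succ_iff.mp (Finset.mem_range.mp hi)
  obtain ⟨j, rfl⟩ := Nat.exists_eq_add_of_le hi'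
  rw [show i + j + 1 - i = j + 1 by omega, show a - b = -(b - a) by ring, neg_pow (b - a),
    neg_pow a, neg_pow b, pow_add (-1 : ℝ) i j, pow_succ (-1 : ℝ) j]
  have h1 : ((-1 : ℝ) ^ j) * (-1) ^ j = 1 := by rw [← mul_pow]; simp
  linear_combination (-((-1 : ℝ) ^ i * (b - a) ^ i / i !) * b ^ (j + 1)) * h1

lemma asymLaplaceMoment_zero_right (k : ℕ) {a : ℝ} (ha : a ≠ 0) :
    asymLaplaceMoment k a 0 = a ^ k * numDerangements k := by
  unfold asymLaplaceMoment
  rw [numDerangements_eq_factorial_mul, expPartialSum]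
  have h : ∑ i ∈ Finset.range (k + 1), (0 - a) ^ i / i ! * (a ^ (k + 1 - i) - (-0) ^ (k + 1 - i))
      = a ^ (k + 1) * ∑ i ∈ Finset.range (k + 1), (-1 : ℝ) ^ i / i ! := by
    rw [Finset.mul_sum]
    refine Finset.sum_congr rfl fun i hi => ?_
    have hi' : i < k + 1 := Finset.mem_range.mp hi
    have h1 : a ^ (k + 1) = a ^ i * a ^ (k + 1 - i) := by rw [← pow_add]; congr 1; omega
    rw [h1, neg_zero, zero_pow (by omega), zero_sub, neg_pow]
    ring
  rw [h, add_zero, pow_succ]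
  field_simp

/-- The contribution of the short side to the moments of an asymmetric Laplace law. -/
noncomputable def laplaceShortSide (n : ℕ) (r : ℝ) : ℝ :=
  ∑ i ∈ Finset.range (n + 1), (1 - r) ^ i / i ! * r ^ (n + 1 - i)

lemma laplaceShortSide_succ (n : ℕ) (r : ℝ) : laplaceShortSide (n + 1) r =
    r * laplaceShortSide n r + r * (1 - r) ^ (n + 1) / (n + 1)! := by
  unfold laplaceShortSide
  rw [Finset.sum_range_succ, Finset.mul_sum]
  congr 1
  · refine Finset.sum_congr rfl fun i hi => ?_
    have hi' : i < n + 1 := Finset.mem_range.mp hi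
    rw [show n + 1 + 1 - i = (n + 1 - i) + 1 by omega, pow_succ]
    ring
  · rw [show n + 1 + 1 - (n + 1) = 1 by omega]; ring

lemma le_laplaceShortSide (n : ℕ) {r : ℝ} (h0 : 0 ≤ r) (h1 : r ≤ 1) :
    r * (1 - r) ^ n / n ! ≤ laplaceShortSide n r := by
  have h2 : 0 ≤ 1 - r := by linarith
  have := Finset.single_le_sum (s := Finset.range (n + 1))
    (f := fun i => (1 - r) ^ i / i ! * r ^ (n + 1 - i)) (fun i _ => by positivity)
    (Finset.self_mem_range_succ n)
  refine le_trans (le_of_eq ?_) this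
  simp only [show n + 1 - n = 1 by omega]
  ring

/-- For even `n` the signs in `(r - 1)^i * (-r)^(n + 1 - i)` multiply to `-1` and cancel the
subtraction, so for `0 ≤ r ≤ 1` the short side contributes only nonnegative terms. -/
lemma asymLaplaceMoment_one_left {n : ℕ} (hn : Even n) {r : ℝ} :
    asymLaplaceMoment n 1 r = n ! * ((expPartialSum n (r - 1) + laplaceShortSide n r) / (1 + r)) := by
  unfold asymLaplaceMoment expPartialSum laplaceShortSide
  rw [← Finset.sum_add_distrib, mul_div_assoc]
  congr 2
  refine Finset.sum_congr rfl fun i hi => ?_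
  have hi' : i ≤ n := Nat.lt_succ_iff.mp (Finset.mem_range.mp hi)
  obtain ⟨j, rfl⟩ := Nat.exists_eq_add_of_le hi'
  rw [show i + j + 1 - i = j + 1 by omega, show 1 - r = -(r - 1) by ring, neg_pow (r - 1),
    neg_pow r, pow_succ (-1 : ℝ) j, one_pow]
  have h1 : ((-1 : ℝ) ^ i) = (-1) ^ j := by
    rcases Nat.even_or_odd i with h | h
    · rw [h.neg_one_pow, ((Nat.even_add.mp hn).mp h).neg_one_pow]
    · have : Odd j := by
        rw [← Nat.not_even_iff_odd] at h ⊢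
        exact fun hj => h ((Nat.even_add.mp hn).mpr hj)
      rw [h.neg_one_pow, this.neg_one_pow]
  rw [h1]
  ring

lemma expPartialSum_neg_one_add_two {n : ℕ} (hn : Even n) :
    expPartialSum (n + 2) (-1) = expPartialSum n (-1) - (n + 1) / (n + 2)! := by
  rw [expPartialSum_succ, expPartialSum_succ, hn.add_one.neg_one_pow,
    hn.add_one.add_one.neg_one_pow, Nat.factorial_succ (n + 1)]
  have : ((n + 1)! : ℝ) ≠ 0 := by positivity
  push_cast
  field_simp
  ring

/-- The recurrences of the two sums give an exact formula for the decrease, with `1 - r^2` as a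
factor, so the denominator `1 + r` divides out. Bounding the short side by its last term leaves `(1
- r)^(n + 1) * (1 + (n + 1) * r)`, and Bernoulli's inequality makes this at least `1 - ((n + 1) *
r)^2`. The constant `(n + 1) / (n + 2)!` is the exact decrease at `r = 0`, so the error is only
quadratic in `r`. -/
lemma asymLaplaceMoment_add_two_le {n : ℕ} (hn : Even n) {r : ℝ} (h0 : 0 ≤ r) (h1 : r ≤ 1) :
    asymLaplaceMoment (n + 2) 1 r / (n + 2)! ≤
      asymLaplaceMoment n 1 r / (n ! : ℝ) - (n + 1) / (n + 2)! * (1 - ((n + 1) * r) ^ 2) := by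
  rw [asymLaplaceMoment_one_left hn, asymLaplaceMoment_one_left (hn.add even_two),
    mul_div_cancel_left₀ _ (by positivity), mul_div_cancel_left₀ _ (by positivity)]
  have hT := le_laplaceShortSide n h0 h1
  have hS : expPartialSum (n + 2) (r - 1) + laplaceShortSide (n + 2) r =
      expPartialSum n (r - 1) + laplaceShortSide n r -
      (1 - r ^ 2) * (laplaceShortSide n r + (1 - r) ^ (n + 1) * ((n + 1) / (n + 2)!)) := by
    rw [expPartialSum_succ, expPartialSum_succ, laplaceShortSide_succ, laplaceShortSide_succ,
      show r - 1 = -(1 - r) by ring, neg_pow, neg_pow (1 - r) (n + 1 + 1), hn.add_one.neg_one_pow,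
      hn.add_one.add_one.neg_one_pow, Nat.factorial_succ (n + 1)]
    have : ((n + 1)! : ℝ) ≠ 0 := by positivity
    push_cast
    field_simp
    ring
  have hbern : 1 - (n + 1) * r ≤ (1 - r) ^ (n + 1) := by
    have := one_add_mul_le_pow (a := -r) (by linarith) (n + 1)
    push_cast at this
    rw [← sub_eq_add_neg] at this
    linarith
  have hx : 0 ≤ 1 - r := by linarith
  rw [hS]
  have e1 : (expPartialSum n (r - 1) + laplaceShortSide n r -
      (1 - r ^ 2) * (laplaceShortSide n r + (1 - r) ^ (n + 1) * ((n + 1) / (n + 2)!))) / (1 + r)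
      = (expPartialSum n (r - 1) + laplaceShortSide n r) / (1 + r) -
      (1 - r) * (laplaceShortSide n r + (1 - r) ^ (n + 1) * ((n + 1) / (n + 2)!)) := by
    have : 1 + r ≠ 0 := by positivity
    field_simp
    ring
  rw [e1]
  have e2 : r * (1 - r) ^ n / n ! = (n + 1) / (n + 2)! * ((n + 2) * r * (1 - r) ^ n) := by
    rw [Nat.factorial_succ (n + 1), Nat.factorial_succ n]
    push_cast
    field_simp
    ring
  rw [e2] at hT
  have hk : (0 : ℝ) ≤ (n + 1) / (n + 2)! := by positivity
  have e3 : (n + 1) / (n + 2)! * (1 - ((n + 1) * r) ^ 2) ≤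
      (n + 1) / (n + 2)! * ((1 - r) ^ (n + 1) * (1 + (n + 1) * r)) := by
    apply mul_le_mul_of_nonneg_left _ hk
    have : 0 ≤ 1 + (n + 1) * r := by positivity
    nlinarith
  have e4 := mul_le_mul_of_nonneg_left hT hx
  have e5 : (1 - r) * (((n : ℝ) + 1) / (n + 2)! * ((n + 2) * r * (1 - r) ^ n)) +
      (1 - r) * ((1 - r) ^ (n + 1) * ((n + 1) / (n + 2)!)) =
      (n + 1) / (n + 2)! * ((1 - r) ^ (n + 1) * (1 + (n + 1) * r)) := by ring
  linarith

/-- The first-order terms of the two sides of the law add up to `r * expPartialSum n (-1)`, which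
the denominator `1 + r` absorbs. The second-order coefficient is at least half of `expPartialSum (n
- 2) (-1)` minus `n / n!`; for `n ≥ 6` the latter is at most `1/120`, leaving room for the `1/5`. -/
lemma le_asymLaplaceMoment {n : ℕ} (hn : Even n) (hn6 : 6 ≤ n) {r : ℝ} (h0 : 0 ≤ r) (h1 : r ≤ 1) :
    expPartialSum n (-1) * (1 + r ^ 2 / 5) ≤ asymLaplaceMoment n 1 r / n ! := by
  rw [asymLaplaceMoment_one_left hn, mul_div_cancel_left₀ _ (by positivity),
    le_div_iff₀ (by positivity)]
  obtain ⟨k, rfl⟩ := Nat.exists_eq_add_of_le' hn6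
  have hT := le_laplaceShortSide (k + 6) h0 h1
  have hE := expPartialSum_second_le (k + 4) h0
  have hbern : 1 - (k + 6) * r ≤ (1 - r) ^ (k + 6) := by
    have := one_add_mul_le_pow (a := -r) (by linarith) (k + 6)
    push_cast at this
    rw [← sub_eq_add_neg] at this
    linarith
  have hT' : r * (1 - (k + 6) * r) / (k + 6)! ≤ laplaceShortSide (k + 6) r := by
    refine le_trans ?_ hT
    gcongr
  have d2 := expPartialSum_neg_one_add_two (n := k + 4) (by
    rcases hn with ⟨j, hj⟩; exact ⟨j - 1, by omega⟩)
  have d1 : expPartialSum (k + 6) (-1) = expPartialSum (k + 5) (-1) + 1 / (k + 6)! := by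
    rw [expPartialSum_succ, hn.neg_one_pow]
  have hδ := third_le_expPartialSum_neg_one (k + 4)
  have hf : (k + 6 : ℝ) / (k + 6)! ≤ 1 / 120 := by
    rw [Nat.factorial_succ (k + 5)]
    have : (120 : ℝ) ≤ (k + 5)! := by
      exact_mod_cast Nat.factorial_le (show 5 ≤ k + 5 by omega)
    have h3 : (0:ℝ) < (k + 5)! := by positivity
    push_cast
    rw [show (k : ℝ) + 5 + 1 = k + 6 by ring, div_mul_eq_div_div, div_self (by positivity)]
    exact one_div_le_one_div_of_le (by norm_num) this
  have d3 : expPartialSum (k + 6) (-1) ≤ expPartialSum (k + 4) (-1) := by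
    have : (0 : ℝ) ≤ ((k + 4 : ℕ) + 1) / (k + 4 + 2)! := by positivity
    rw [show k + 4 + 2 = k + 6 by ring] at *
    linarith
  have e1 : r * (1 - (k + 6) * r) / (k + 6)! = r * (1 / (k + 6)!) - r ^ 2 * ((k + 6) / (k + 6)!) := by
    ring
  rw [e1] at hT'
  simp only [show k + 4 + 2 = k + 6 by ring, show k + 4 + 1 = k + 5 by ring] at hE hδ
  generalize expPartialSum (k + 6) (-1) = D at *
  have hr2 : 0 ≤ r ^ 2 := by positivity
  have g1 := mul_le_mul_of_nonneg_left hf hr2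
  have g2 := mul_le_mul_of_nonneg_left d3 hr2
  have g3 : 0 ≤ D * (r ^ 2 * (1 - r)) := by
    have : 0 ≤ D := by linarith
    have : 0 ≤ 1 - r := by linarith
    positivity
  have g4 := mul_le_mul_of_nonneg_left hδ hr2
  have g5 : r * expPartialSum (k + 5) (-1) = r * D - r * (1 / (k + 6)!) := by rw [d1]; ring
  nlinarith

/-- The `5` inverts the `1/5` of `le_asymLaplaceMoment`, and `2/3` is twice the lower bound `1/3` on
the normalized derangement numbers. -/
lemma factorial_growth {n : ℕ} (hn : 6 ≤ n) :
    (n : ℝ) * ((n + 1) / (n + 2)! * (1 + 5 * (n + 1) ^ 2)) < 2 / 3 := by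
  obtain ⟨k, rfl⟩ := Nat.exists_eq_add_of_le' hn
  have h6 : (6 : ℝ) ≤ (k + 3)! := by
    exact_mod_cast Nat.factorial_le (show 3 ≤ k + 3 by omega)
  have hf : ((k + 6 + 2)! : ℝ) = (k + 8) * ((k + 7) * ((k + 6) * ((k + 5) * ((k + 4) * (k + 3)!)))) := by
    simp only [Nat.factorial_succ (k + 7), Nat.factorial_succ (k + 6), Nat.factorial_succ (k + 5),
      Nat.factorial_succ (k + 4), Nat.factorial_succ (k + 3)]
    push_cast
    ring
  rw [show ((k + 6 : ℕ) : ℝ) * (((k + 6 : ℕ) + 1) / (k + 6 + 2)! * (1 + 5 * ((k + 6 : ℕ) + 1) ^ 2))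
    = (1 + 5 * (k + 7) ^ 2) / ((k + 8) * ((k + 5) * ((k + 4) * (k + 3)!))) by
      rw [hf]; push_cast; field_simp; ring]
  rw [div_lt_iff₀ (by positivity)]
  have h1 : (2 / 3 : ℝ) * ((k + 8) * ((k + 5) * ((k + 4) * 6))) ≤
      2 / 3 * ((k + 8) * ((k + 5) * ((k + 4) * (k + 3)!))) := by gcongr
  have hk : (0 : ℝ) ≤ k := by positivity
  refine lt_of_lt_of_le ?_ h1
  have : (0 : ℝ) ≤ k ^ 3 := by positivity
  nlinarith

lemma asymLaplaceMoment_one_left_lt {n : ℕ} (hn : Even n) (hn6 : 6 ≤ n) {r : ℝ}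
    (h0 : 0 < r) (h1 : r ≤ 1) :
    (asymLaplaceMoment (n + 2) 1 r / numDerangements (n + 2)) ^ n <
      (asymLaplaceMoment n 1 r / numDerangements n) ^ (n + 2) := by
  have hA := asymLaplaceMoment_add_two_le hn h0.le h1
  have hB := le_asymLaplaceMoment hn hn6 h0.le h1
  have hC := factorial_growth hn6
  have hD := expPartialSum_neg_one_add_two hn
  have hE := third_le_expPartialSum_neg_one n
  have hpos : 0 ≤ asymLaplaceMoment (n + 2) 1 r := by
    rw [asymLaplaceMoment_one_left (hn.add even_two)]
    have := expPartialSum_zeroth_le (n + 2) h0.le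
    have := le_laplaceShortSide (n + 2) h0.le h1
    have : 0 ≤ r * (1 - r) ^ (n + 2) / (n + 2)! := by
      have : 0 ≤ 1 - r := by linarith
      positivity
    have : 0 ≤ expPartialSum (n + 2) (r - 1) + laplaceShortSide (n + 2) r := by linarith
    positivity
  rw [numDerangements_eq_factorial_mul, numDerangements_eq_factorial_mul, ← div_div, ← div_div]
  have hpos' : 0 ≤ asymLaplaceMoment (n + 2) 1 r / (n + 2)! := by positivity
  set m' := asymLaplaceMoment (n + 2) 1 r / (n + 2)!
  set m := asymLaplaceMoment n 1 r / (n ! : ℝ)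
  set δ := expPartialSum n (-1)
  set δ' := expPartialSum (n + 2) (-1)
  set κ : ℝ := (n + 1) / (n + 2)!
  have hκ : 0 < κ := by positivity
  have hδ : 0 < δ := by linarith
  have hn0 : (0 : ℝ) < n := by positivity
  set u := m / δ
  have hu : m = δ * u := by simp only [u]; field_simp
  have hv : r ^ 2 / 5 ≤ u - 1 := by
    rw [hu] at hB
    have := le_of_mul_le_mul_left hB hδ
    linarith
  have hr2 : 0 < r ^ 2 := by positivity
  have hv0 : 0 < u - 1 := by linarith
  -- Both errors are controlled by `u - 1`: the quadratic one through `r^2 ≤ 5 * (u - 1)`, the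
  -- change of normalization through `δ = δ' + κ`.
  have key : m' / δ' < u + 2 / n * (u - 1) := by
    rw [div_lt_iff₀ (by linarith)]
    have h2 : κ * (1 + 5 * (n + 1) ^ 2) < 2 / n * δ' := by
      rw [show 2 / (n : ℝ) * δ' = 2 * δ' / n by ring, lt_div_iff₀ hn0]
      linarith
    have h3 := mul_lt_mul_of_pos_right h2 hv0
    have h4 : κ * (n + 1) ^ 2 * r ^ 2 ≤ κ * (n + 1) ^ 2 * (5 * (u - 1)) := by
      gcongr; linarith
    have h5 : m' ≤ δ * u - κ + κ * (n + 1) ^ 2 * r ^ 2 := by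
      rw [← hu]; nlinarith
    have h6 : δ = δ' + κ := by linarith
    rw [h6] at h5
    nlinarith
  have hu0 : 0 < u := by linarith
  -- The coefficient `2 / n` is what `1 + x ≤ exp x` and `1 - 1/u ≤ log u` convert into exactly two
  -- more powers of `u`.
  calc (m' / δ') ^ n < (u + 2 / n * (u - 1)) ^ n := by
        apply pow_lt_pow_left₀ key (by apply div_nonneg hpos' (by linarith)) (by omega)
    _ = u ^ n * (2 / n * (1 - u⁻¹) + 1) ^ n := by
        rw [← mul_pow]; congr 1; field_simp; ring
    _ ≤ u ^ n * Real.exp (2 / n * (1 - u⁻¹)) ^ n := by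
        have : u⁻¹ ≤ 1 := inv_le_one_of_one_le₀ (by linarith)
        have : 0 ≤ 2 / n * (1 - u⁻¹) := by
          apply mul_nonneg (by positivity); linarith
        gcongr
        exact Real.add_one_le_exp _
    _ = u ^ n * Real.exp (2 * (1 - u⁻¹)) := by
        rw [← Real.exp_nat_mul]; congr 2; field_simp
    _ ≤ u ^ n * Real.exp (2 * Real.log u) := by
        gcongr
        exact Real.one_sub_inv_le_log_of_pos hu0
    _ = u ^ (n + 2) := by
        rw [pow_add, mul_comm 2, Real.exp_mul, Real.exp_log hu0]
        norm_num

lemma numDerangements_values : numDerangements 2 = 1 ∧ numDerangements 4 = 9 ∧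
    numDerangements 6 = 265 := by decide

lemma asymLaplaceMoment_two {r : ℝ} (h0 : 0 < r) : asymLaplaceMoment 2 1 r = 1 + r ^ 2 := by
  simp only [asymLaplaceMoment, Finset.sum_range_succ, Finset.sum_range_zero, Nat.factorial]
  have : 1 + r ≠ 0 := by positivity
  norm_num
  field_simp
  ring

lemma asymLaplaceMoment_four {r : ℝ} (h0 : 0 < r) :
    asymLaplaceMoment 4 1 r = 9 + 6 * r ^ 2 + 9 * r ^ 4 := by
  simp only [asymLaplaceMoment, Finset.sum_range_succ, Finset.sum_range_zero, Nat.factorial]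
  have : 1 + r ≠ 0 := by positivity
  norm_num
  field_simp
  ring

lemma asymLaplaceMoment_six {r : ℝ} (h0 : 0 < r) : asymLaplaceMoment 6 1 r =
    265 + 135 * r ^ 2 - 80 * r ^ 3 + 135 * r ^ 4 + 265 * r ^ 6 := by
  simp only [asymLaplaceMoment, Finset.sum_range_succ, Finset.sum_range_zero, Nat.factorial]
  have : 1 + r ≠ 0 := by positivity
  norm_num
  field_simp
  ring

theorem asymLaplaceMoment_pow_lt {n : ℕ} (hn : Even n) (hn2 : 2 ≤ n) {a b : ℝ}
    (ha : 0 < a) (hb : 0 < b) :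
    (asymLaplaceMoment (n + 2) a b / numDerangements (n + 2)) ^ n <
      (asymLaplaceMoment n a b / numDerangements n) ^ (n + 2) := by
  wlog hab : b ≤ a generalizing a b
  · have := this hb ha (le_of_not_ge hab)
    rwa [asymLaplaceMoment_swap, asymLaplaceMoment_swap n, hn.neg_one_pow,
      (hn.add even_two).neg_one_pow, one_mul, one_mul] at this
  suffices H : ∀ r : ℝ, 0 < r → r ≤ 1 →
      (asymLaplaceMoment (n + 2) 1 r / numDerangements (n + 2)) ^ n <
      (asymLaplaceMoment n 1 r / numDerangements n) ^ (n + 2) by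
    have h := H (b / a) (by positivity) ((div_le_one ha).mpr hab)
    have e : ∀ k, asymLaplaceMoment k a b = a ^ k * asymLaplaceMoment k 1 (b / a) := by
      intro k
      rw [← asymLaplaceMoment_mul ha.ne', mul_one, mul_div_cancel₀ _ ha.ne']
    rw [e, e, mul_div_assoc, mul_div_assoc, mul_pow, mul_pow, ← pow_mul, ← pow_mul, mul_comm n]
    exact mul_lt_mul_of_pos_left h (by positivity)
  intro r h0 h1
  obtain ⟨d2, d4, d6⟩ := numDerangements_values
  rcases lt_or_ge n 6 with h6 | h6
  · obtain rfl | rfl : n = 2 ∨ n = 4 := by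
      rcases hn with ⟨j, hj⟩; omega
    · rw [asymLaplaceMoment_two h0, asymLaplaceMoment_four h0, d2, d4]
      push_cast
      have : 0 < r ^ 2 := by positivity
      have h3 : (9 + 6 * r ^ 2 + 9 * r ^ 4) / 9 < (1 + r ^ 2) ^ 2 := by nlinarith
      calc _ < ((1 + r ^ 2) ^ 2) ^ 2 := pow_lt_pow_left₀ h3 (by positivity) (by norm_num)
        _ = _ := by ring
    · rw [asymLaplaceMoment_four h0, asymLaplaceMoment_six h0, d4, d6]
      push_cast
      -- The cubic term is dropped and `135/265` rounded up to `0.6`; the fourth and sixth powers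
      -- can then be compared through their square roots, whose difference has only positive
      -- coefficients.
      have h3 : (265 + 135 * r ^ 2 - 80 * r ^ 3 + 135 * r ^ 4 + 265 * r ^ 6) / 265 ≤
          1 + 0.6 * r ^ 2 + 0.6 * r ^ 4 + r ^ 6 := by
        have : 0 < r ^ 2 := by positivity
        have : 0 < r ^ 3 := by positivity
        have : 0 < r ^ 4 := by positivity
        nlinarith
      have h4 : 0 ≤ (265 + 135 * r ^ 2 - 80 * r ^ 3 + 135 * r ^ 4 + 265 * r ^ 6) / 265 := by
        have : r ^ 3 ≤ r ^ 2 := pow_le_pow_of_le_one h0.le h1 (by norm_num)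
        have : 0 < r ^ 2 := by positivity
        have : 0 < r ^ 4 := by positivity
        have : 0 < r ^ 6 := by positivity
        apply div_nonneg _ (by norm_num)
        linarith
      have h5 := pow_le_pow_left₀ h4 h3 4
      refine h5.trans_lt ?_
      have h6 : (1 + 0.6 * r ^ 2 + 0.6 * r ^ 4 + r ^ 6) ^ 2 <
          ((9 + 6 * r ^ 2 + 9 * r ^ 4) / 9) ^ 3 := by
        rw [← sub_pos]
        ring_nf
        positivity
      calc _ = ((1 + 0.6 * r ^ 2 + 0.6 * r ^ 4 + r ^ 6) ^ 2) ^ 2 := by ring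
        _ < (((9 + 6 * r ^ 2 + 9 * r ^ 4) / 9) ^ 3) ^ 2 :=
          pow_lt_pow_left₀ h6 (by positivity) (by norm_num)
        _ = _ := by ring
  · exact asymLaplaceMoment_one_left_lt hn h6 h0 h1

end AsymmetricLaplaceMoments

/-! ### Primitives and integration by parts. -/

/-- All the polynomial moments of `φ` are finite. -/
def HasMoments (φ : ℝ → ℝ) : Prop := ∀ k : ℕ, Integrable (fun x => x ^ k * φ x)

lemma HasMoments.integrable {φ : ℝ → ℝ} (h : HasMoments φ) : Integrable φ := by
  simpa using h 0

/-- The primitive of `φ` that vanishes at `-∞`. -/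
noncomputable def primitiveIic (φ : ℝ → ℝ) (x : ℝ) : ℝ := ∫ t in Set.Iic x, φ t

/-- The kernel that turns `φ` into minus its primitive, and `s ^ k` into its primitive. -/
noncomputable def primitiveKernel (s t : ℝ) : ℝ :=
  if 0 < s then (if s < t then 1 else 0) else (if t ≤ s then -1 else 0)

lemma measurable_primitiveKernel : Measurable fun z : ℝ × ℝ => primitiveKernel z.1 z.2 := by
  unfold primitiveKernel
  refine Measurable.ite (measurableSet_lt measurable_const measurable_fst) ?_ ?_
  · exact Measurable.ite (measurableSet_lt measurable_fst measurable_snd) measurable_const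
      measurable_const
  · exact Measurable.ite (measurableSet_le measurable_snd measurable_fst) measurable_const
      measurable_const

lemma integral_primitiveKernel_mul {φ : ℝ → ℝ} (hφ : Integrable φ) (h0 : ∫ t, φ t = 0) (s : ℝ) :
    ∫ t, primitiveKernel s t * φ t = -primitiveIic φ s := by
  unfold primitiveKernel primitiveIic
  split_ifs with hs
  · have : (fun t => (if s < t then (1 : ℝ) else 0) * φ t) = (Set.Ioi s).indicator φ := by
      funext t; by_cases h : s < t <;> simp [h]
    rw [this, integral_indicator measurableSet_Ioi, ← Set.compl_Iic]
    have := integral_add_compl (measurableSet_Iic (a := s)) hφ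
    linarith
  · have : (fun t => (if t ≤ s then (-1 : ℝ) else 0) * φ t) =
        (Set.Iic s).indicator (fun t => -φ t) := by
      funext t; by_cases h : t ≤ s <;> simp [h]
    rw [this, integral_indicator measurableSet_Iic, integral_neg]

lemma integral_mul_primitiveKernel {f : ℝ → ℝ} (hf : Continuous f) (t : ℝ) :
    Integrable (fun s => f s * primitiveKernel s t) ∧
      ∫ s, f s * primitiveKernel s t = ∫ s in (0 : ℝ)..t, f s := by
  unfold primitiveKernel
  rcases le_total 0 t with ht | ht
  · have : (fun s => f s * (if 0 < s then (if s < t then 1 else 0) else (if t ≤ s then -1 else 0)))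
        =ᵐ[volume] (Set.Ioc 0 t).indicator f := by
      filter_upwards [compl_mem_ae_iff.mpr (measure_singleton (μ := volume) (0 : ℝ)),
        compl_mem_ae_iff.mpr (measure_singleton (μ := volume) t)] with s h1 h2
      simp only [Set.mem_compl_iff, Set.mem_singleton_iff] at h1 h2
      by_cases h : 0 < s
      · by_cases h' : s < t
        · simp [h, h', h'.le]
        · have : ¬ s ≤ t := fun h3 => h' (lt_of_le_of_ne h3 h2)
          simp [h, h', this]
      · have : ¬ t ≤ s := fun h3 => h1 (le_antisymm (not_lt.mp h) (ht.trans h3))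
        simp [h, this]
    refine ⟨Integrable.congr ?_ this.symm, ?_⟩
    · exact (integrable_indicator_iff measurableSet_Ioc).mpr
        ((intervalIntegrable_iff_integrableOn_Ioc_of_le ht).mp (hf.intervalIntegrable 0 t))
    · rw [integral_congr_ae this, integral_indicator measurableSet_Ioc,
        intervalIntegral.integral_of_le ht]
  · have : (fun s => f s * (if 0 < s then (if s < t then 1 else 0) else (if t ≤ s then -1 else 0)))
        =ᵐ[volume] (Set.Ioc t 0).indicator (fun s => -f s) := by
      filter_upwards [compl_mem_ae_iff.mpr (measure_singleton (μ := volume) t)] with s h2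
      simp only [Set.mem_compl_iff, Set.mem_singleton_iff] at h2
      by_cases h : 0 < s
      · have h' : ¬ s < t := by linarith
        have : ¬ s ≤ 0 := by linarith
        simp [h, h', this]
      · by_cases h' : t ≤ s
        · have : t < s := lt_of_le_of_ne h' (Ne.symm h2)
          simp [h, h', this, not_lt.mp h]
        · have : ¬ t < s := fun h3 => h' h3.le
          simp [h, h', this]
    refine ⟨Integrable.congr ?_ this.symm, ?_⟩
    · exact (integrable_indicator_iff measurableSet_Ioc).mpr
        ((intervalIntegrable_iff_integrableOn_Ioc_of_le ht).mp
          ((hf.neg).intervalIntegrable t 0))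
    · rw [integral_congr_ae this, integral_indicator measurableSet_Ioc,
        intervalIntegral.integral_symm, intervalIntegral.integral_of_le ht, integral_neg]

lemma integral_abs_pow_primitiveKernel (k : ℕ) (t : ℝ) :
    ∫ s, |s ^ k * primitiveKernel s t| = |t ^ (k + 1)| / (k + 1) := by
  have h := (integral_mul_primitiveKernel (f := fun s => |s ^ k|) (by fun_prop) t).2
  -- For fixed `t` the kernel has constant sign in `s`, the sign of `t`.
  have hsgn : ∀ s, |s ^ k * primitiveKernel s t| =
      (if 0 < t then 1 else -1) * (|s ^ k| * primitiveKernel s t) := by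
    intro s
    rw [abs_mul]
    unfold primitiveKernel
    split_ifs <;> first | (exfalso; linarith) | simp
  simp_rw [hsgn]
  rw [integral_const_mul, h]
  rcases lt_or_ge 0 t with ht | ht
  · rw [if_pos ht, one_mul, intervalIntegral.integral_congr (g := fun s => s ^ k), integral_pow,
      abs_of_nonneg (by positivity)]
    · simp
    · intro s hs
      rw [Set.uIcc_of_le ht.le] at hs
      exact abs_of_nonneg (pow_nonneg hs.1 k)
  · rw [if_neg (not_lt.mpr ht), intervalIntegral.integral_symm,
      intervalIntegral.integral_congr (g := fun s => (-s) ^ k),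
      intervalIntegral.integral_comp_neg (fun s => s ^ k), integral_pow]
    · rw [show t ^ (k + 1) = (-1) ^ (k + 1) * (-t) ^ (k + 1) by rw [← mul_pow]; simp, abs_mul,
        abs_pow, abs_of_nonneg (pow_nonneg (by linarith : 0 ≤ -t) _)]
      simp
    · intro s hs
      rw [Set.uIcc_of_le ht] at hs
      change |s ^ k| = (-s) ^ k
      rw [abs_pow, abs_of_nonpos hs.2]

/-- Integration by parts, done by Fubini on `s^k * primitiveKernel s t * φ t`, so that no boundary
terms arise. The kernel splits at `0`, using the upper tail of `φ` for positive `s` and the lower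
tail otherwise; this makes the double integral absolutely convergent. -/
lemma integrable_and_integral_pow_mul_primitiveIic {φ : ℝ → ℝ} (hφ : Integrable φ)
    (h0 : ∫ t, φ t = 0) (k : ℕ) (hk : Integrable (fun t => t ^ (k + 1) * φ t)) :
    Integrable (fun s => s ^ k * primitiveIic φ s) ∧
      (k + 1) * ∫ s, s ^ k * primitiveIic φ s = -∫ t, t ^ (k + 1) * φ t := by
  have hm : AEStronglyMeasurable
      (fun z : ℝ × ℝ => z.1 ^ k * primitiveKernel z.1 z.2 * φ z.2) (volume.prod volume) := by
    refine AEStronglyMeasurable.mul ?_ hφ.aestronglyMeasurable.comp_snd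
    exact ((measurable_fst.pow_const k).mul measurable_primitiveKernel).aestronglyMeasurable
  have hint : Integrable (fun z : ℝ × ℝ => z.1 ^ k * primitiveKernel z.1 z.2 * φ z.2)
      (volume.prod volume) := by
    rw [integrable_prod_iff' hm]
    refine ⟨Filter.Eventually.of_forall fun t => ?_, ?_⟩
    · exact (integral_mul_primitiveKernel (f := fun s => s ^ k) (by fun_prop) t).1.mul_const (φ t)
    · have : (fun t => ∫ s, ‖s ^ k * primitiveKernel s t * φ t‖) =
          fun t => ‖t ^ (k + 1) * φ t‖ / (k + 1) := by
        funext t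
        simp_rw [norm_mul _ (φ t)]
        rw [integral_mul_const]
        simp_rw [Real.norm_eq_abs]
        rw [integral_abs_pow_primitiveKernel]
        ring
      rw [this]
      exact hk.norm.div_const _
  have e1 : ∀ s, ∫ t, s ^ k * primitiveKernel s t * φ t = -(s ^ k * primitiveIic φ s) := by
    intro s
    simp_rw [mul_assoc]
    rw [integral_const_mul, integral_primitiveKernel_mul hφ h0]
    ring
  have e2 : ∀ t, ∫ s, s ^ k * primitiveKernel s t * φ t = t ^ (k + 1) * φ t / (k + 1) := by
    intro t
    rw [integral_mul_const, (integral_mul_primitiveKernel (f := fun s => s ^ k) (by fun_prop) t).2,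
      integral_pow]
    simp
    ring
  constructor
  · have := hint.integral_prod_left
    simp_rw [e1] at this
    simpa using this.neg
  · have := integral_integral_swap (f := fun s t => s ^ k * primitiveKernel s t * φ t) hint
    simp_rw [e1, e2] at this
    rw [integral_neg, integral_div] at this
    have h3 : (k + 1 : ℝ) ≠ 0 := by positivity
    rw [eq_div_iff h3] at this
    linarith

lemma HasMoments.primitiveIic {φ : ℝ → ℝ} (h : HasMoments φ) (h0 : ∫ t, φ t = 0) :
    HasMoments (primitiveIic φ) := fun k =>
  (integrable_and_integral_pow_mul_primitiveIic h.integrable h0 k (h (k + 1))).1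

lemma HasMoments.integral_pow_mul_primitiveIic {φ : ℝ → ℝ} (h : HasMoments φ) (h0 : ∫ t, φ t = 0)
    (k : ℕ) : (k + 1) * ∫ s, s ^ k * _root_.primitiveIic φ s = -∫ t, t ^ (k + 1) * φ t :=
  (integrable_and_integral_pow_mul_primitiveIic h.integrable h0 k (h (k + 1))).2

lemma primitiveIic_sub {φ : ℝ → ℝ} (h : Integrable φ) (x y : ℝ) :
    primitiveIic φ y - primitiveIic φ x = ∫ t in x..y, φ t :=
  intervalIntegral.integral_Iic_sub_Iic h.integrableOn h.integrableOn

lemma continuous_primitiveIic {φ : ℝ → ℝ} (h : Integrable φ) : Continuous (primitiveIic φ) := by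
  have : primitiveIic φ = fun x => primitiveIic φ 0 + ∫ t in (0 : ℝ)..x, φ t := by
    funext x
    rw [← primitiveIic_sub h]; ring
  rw [this]
  exact continuous_const.add
    (intervalIntegral.continuous_primitive (fun a b => h.intervalIntegrable) 0)

lemma hasDerivAt_primitiveIic {φ : ℝ → ℝ} (h : Integrable φ) (hc : Continuous φ) (x : ℝ) :
    HasDerivAt (primitiveIic φ) (φ x) x := by
  have : primitiveIic φ = fun x => primitiveIic φ 0 + ∫ t in (0 : ℝ)..x, φ t := by
    funext x
    rw [← primitiveIic_sub h]; ring
  rw [this]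
  exact (intervalIntegral.integral_hasDerivAt_right (hc.intervalIntegrable 0 x)
    (hc.stronglyMeasurableAtFilter _ _) hc.continuousAt).const_add _

lemma primitiveIic_neg (φ : ℝ → ℝ) (x : ℝ) :
    primitiveIic (fun t => -φ t) x = -primitiveIic φ x := integral_neg _

lemma exists_pos_le_of_primitiveIic_pos {φ : ℝ → ℝ} {q : ℝ} (hq : 0 < primitiveIic φ q) :
    ∃ p ≤ q, 0 < φ p := by
  by_contra! H
  exact absurd (setIntegral_nonpos measurableSet_Iic fun x hx => H x hx) (not_le.mpr hq)

lemma exists_neg_le_of_primitiveIic_neg {φ : ℝ → ℝ} {q : ℝ} (hq : primitiveIic φ q < 0) :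
    ∃ p ≤ q, φ p < 0 := by
  by_contra! H
  exact absurd (setIntegral_nonneg measurableSet_Iic fun x hx => H x hx) (not_le.mpr hq)

lemma exists_pos_of_primitiveIic_lt {φ : ℝ → ℝ} (h : Integrable φ) {a b : ℝ} (hab : a < b)
    (hq : primitiveIic φ a < primitiveIic φ b) : ∃ p, a < p ∧ p ≤ b ∧ 0 < φ p := by
  by_contra! H
  have h1 := primitiveIic_sub h a b
  rw [intervalIntegral.integral_of_le hab.le] at h1
  have := setIntegral_nonpos (μ := volume) measurableSet_Ioc
    fun x (hx : x ∈ Set.Ioc a b) => H x hx.1 hx.2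
  linarith

lemma exists_neg_of_primitiveIic_lt {φ : ℝ → ℝ} (h : Integrable φ) {a b : ℝ} (hab : a < b)
    (hq : primitiveIic φ b < primitiveIic φ a) : ∃ p, a < p ∧ p ≤ b ∧ φ p < 0 := by
  obtain ⟨p, h1, h2, h3⟩ := exists_pos_of_primitiveIic_lt h.neg hab
    (by
      have := primitiveIic_neg φ a
      have h' := primitiveIic_neg φ b
      change primitiveIic (fun t => -φ t) a < primitiveIic (fun t => -φ t) b
      linarith)
  exact ⟨p, h1, h2, by simpa using h3⟩

lemma exists_neg_gt_of_primitiveIic_pos {φ : ℝ → ℝ} (h : Integrable φ) (h0 : ∫ t, φ t = 0) {q : ℝ}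
    (hq : 0 < primitiveIic φ q) : ∃ p > q, φ p < 0 := by
  by_contra! H
  have h1 := integral_add_compl (measurableSet_Iic (a := q)) h
  rw [Set.compl_Iic] at h1
  have := setIntegral_nonneg (μ := volume) measurableSet_Ioi fun x (hx : x ∈ Set.Ioi q) => H x hx
  unfold primitiveIic at hq
  linarith

lemma exists_pos_gt_of_primitiveIic_neg {φ : ℝ → ℝ} (h : Integrable φ) (h0 : ∫ t, φ t = 0) {q : ℝ}
    (hq : primitiveIic φ q < 0) : ∃ p > q, 0 < φ p := by
  obtain ⟨p, hp, h1⟩ := exists_neg_gt_of_primitiveIic_pos h.neg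
    (by simpa [integral_neg] using h0) (q := q)
    (by
      change 0 < primitiveIic (fun t => -φ t) q
      rw [primitiveIic_neg]; linarith)
  exact ⟨p, hp, by simpa using h1⟩

/-! ### Sign changes and the moment comparison they imply. -/

/-- `φ` takes a negative, a positive, a negative and a positive value, in this order. -/
def AlternatesFour (φ : ℝ → ℝ) : Prop :=
  ∃ p₁ p₂ p₃ p₄, p₁ < p₂ ∧ p₂ < p₃ ∧ p₃ < p₄ ∧ φ p₁ < 0 ∧ 0 < φ p₂ ∧ φ p₃ < 0 ∧ 0 < φ p₄

/-- `φ` takes a positive, a negative, a positive, a negative and a positive value, in this order. -/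
def AlternatesFive (φ : ℝ → ℝ) : Prop :=
  ∃ p₁ p₂ p₃ p₄ p₅, p₁ < p₂ ∧ p₂ < p₃ ∧ p₃ < p₄ ∧ p₄ < p₅ ∧
    0 < φ p₁ ∧ φ p₂ < 0 ∧ 0 < φ p₃ ∧ φ p₄ < 0 ∧ 0 < φ p₅

lemma HasMoments.integral_primitiveIic {φ : ℝ → ℝ} (h : HasMoments φ) (h0 : ∫ t, φ t = 0)
    (h1 : ∫ t, t * φ t = 0) :
    ∫ t, _root_.primitiveIic φ t = 0 := by
  have := h.integral_pow_mul_primitiveIic h0 0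
  simpa [h1] using this

/-- A Rolle argument applied twice: a primitive vanishing at both infinities has one sign change
fewer than its integrand. The pattern `- +` of the double primitive forces `- + -` for the primitive
and `- + - +` for `φ`. -/
lemma alternatesFour_of_primitiveIic {φ : ℝ → ℝ} (h : HasMoments φ) (h0 : ∫ t, φ t = 0)
    (h1 : ∫ t, t * φ t = 0) {u v : ℝ} (huv : u < v)
    (hu : primitiveIic (primitiveIic φ) u < 0) (hv : 0 < primitiveIic (primitiveIic φ) v) :
    AlternatesFour φ := by
  have hΦ0 := h.integral_primitiveIic h0 h1
  have hΦ := (h.primitiveIic h0).integrable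
  obtain ⟨q₁, a1, b1⟩ := exists_neg_le_of_primitiveIic_neg hu
  obtain ⟨q₂, a2, a2', b2⟩ := exists_pos_of_primitiveIic_lt hΦ huv (hu.trans hv)
  obtain ⟨q₃, a3, b3⟩ := exists_neg_gt_of_primitiveIic_pos hΦ hΦ0 hv
  obtain ⟨p₁, c1, d1⟩ := exists_neg_le_of_primitiveIic_neg b1
  obtain ⟨p₂, c2, c2', d2⟩ := exists_pos_of_primitiveIic_lt h.integrable (a1.trans_lt a2)
    (b1.trans b2)
  obtain ⟨p₃, c3, c3', d3⟩ := exists_neg_of_primitiveIic_lt h.integrable (a2'.trans_lt a3)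
    (b3.trans b2)
  obtain ⟨p₄, c4, d4⟩ := exists_pos_gt_of_primitiveIic_neg h.integrable h0 b3
  exact ⟨p₁, p₂, p₃, p₄, by linarith, by linarith, by linarith, d1, d2, d3, d4⟩

lemma alternatesFive_of_primitiveIic {φ : ℝ → ℝ} (h : HasMoments φ) (h0 : ∫ t, φ t = 0)
    (h1 : ∫ t, t * φ t = 0) {u v w : ℝ} (huv : u < v) (hvw : v < w)
    (hu : 0 < primitiveIic (primitiveIic φ) u) (hv : primitiveIic (primitiveIic φ) v < 0)
    (hw : 0 < primitiveIic (primitiveIic φ) w) : AlternatesFive φ := by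
  have hΦ0 := h.integral_primitiveIic h0 h1
  have hΦ := (h.primitiveIic h0).integrable
  obtain ⟨q₁, a1, b1⟩ := exists_pos_le_of_primitiveIic_pos hu
  obtain ⟨q₂, a2, a2', b2⟩ := exists_neg_of_primitiveIic_lt hΦ huv (hv.trans hu)
  obtain ⟨q₃, a3, a3', b3⟩ := exists_pos_of_primitiveIic_lt hΦ hvw (hv.trans hw)
  obtain ⟨q₄, a4, b4⟩ := exists_neg_gt_of_primitiveIic_pos hΦ hΦ0 hw
  obtain ⟨p₁, c1, d1⟩ := exists_pos_le_of_primitiveIic_pos b1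
  obtain ⟨p₂, c2, c2', d2⟩ := exists_neg_of_primitiveIic_lt h.integrable (a1.trans_lt a2)
    (b2.trans b1)
  obtain ⟨p₃, c3, c3', d3⟩ := exists_pos_of_primitiveIic_lt h.integrable (a2'.trans_lt a3)
    (b2.trans b3)
  obtain ⟨p₄, c4, c4', d4⟩ := exists_neg_of_primitiveIic_lt h.integrable (a3'.trans_lt a4)
    (b4.trans b3)
  obtain ⟨p₅, c5, d5⟩ := exists_pos_gt_of_primitiveIic_neg h.integrable h0 b4
  exact ⟨p₁, p₂, p₃, p₄, p₅, by linarith, by linarith, by linarith, by linarith,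
    d1, d2, d3, d4, d5⟩

lemma HasMoments.integral_pow_mul_primitiveIic_primitiveIic {φ : ℝ → ℝ} (h : HasMoments φ) (h0 : ∫ t, φ t = 0)
    (h1 : ∫ t, t * φ t = 0) (k : ℕ) :
    (k + 2) * ((k + 1) * ∫ s, s ^ k * _root_.primitiveIic (_root_.primitiveIic φ) s) =
      ∫ t, t ^ (k + 2) * φ t := by
  have e1 := h.integral_pow_mul_primitiveIic h0 (k + 1)
  have e2 := (h.primitiveIic h0).integral_pow_mul_primitiveIic (h.integral_primitiveIic h0 h1) k
  rw [e2]
  push_cast at e1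
  linarith

/-- A nonnegative integrand with zero integral vanishes almost everywhere; the weight `r` vanishes
only on a finite set, and continuity of `H` does the rest. -/
lemma eq_zero_of_mul_nonneg_of_integral_eq_zero {H r : ℝ → ℝ} (hH : Continuous H)
    {S : Set ℝ} (hS : S.Finite) (hr : ∀ x ∉ S, r x ≠ 0) (hint : Integrable (fun x => r x * H x))
    (hnn : ∀ x, 0 ≤ r x * H x) (h0 : ∫ x, r x * H x = 0) : ∀ x, H x = 0 := by
  have h1 := (integral_eq_zero_iff_of_nonneg hnn hint).mp h0
  have h2 : H =ᵐ[volume] fun _ => 0 := by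
    filter_upwards [h1, compl_mem_ae_iff.mpr (hS.measure_zero volume)] with x hx hxS
    exact (mul_eq_zero.mp hx).resolve_left (hr x hxS)
  exact congrFun ((Continuous.ae_eq_iff_eq volume hH continuous_const).mp h2)

lemma eq_zero_of_mul_nonpos_of_integral_eq_zero {H r : ℝ → ℝ} (hH : Continuous H)
    {S : Set ℝ} (hS : S.Finite) (hr : ∀ x ∉ S, r x ≠ 0) (hint : Integrable (fun x => r x * H x))
    (hnn : ∀ x, r x * H x ≤ 0) (h0 : ∫ x, r x * H x = 0) : ∀ x, H x = 0 := by
  refine eq_zero_of_mul_nonneg_of_integral_eq_zero (r := fun x => -r x) hH hS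
    (fun x hx => neg_ne_zero.mpr (hr x hx)) ?_ ?_ ?_
  · simpa using hint.neg
  · intro x; have := hnn x; linarith
  · simpa [integral_neg] using h0

lemma primitiveIic_eq_zero_of_primitiveIic_primitiveIic {φ : ℝ → ℝ} (h : HasMoments φ)
    (h0 : ∫ t, φ t = 0) (hH : ∀ x, primitiveIic (primitiveIic φ) x = 0) (x : ℝ) :
    primitiveIic φ x = 0 := by
  have h1 := hasDerivAt_primitiveIic (h.primitiveIic h0).integrable
    (continuous_primitiveIic h.integrable) x
  have h2 : primitiveIic (primitiveIic φ) = fun _ => 0 := funext hH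
  rw [h2] at h1
  exact h1.unique (hasDerivAt_const x 0)

/-- The double primitive `H` can pass from positive to negative at a point `α` but not back, so `(x
- α) * x^n * H x ≤ 0`. Since `∫ x^n H = 0`, the term in `α` drops out and the next moment is
nonpositive. If it vanishes, then `H = 0`. -/
lemma moment_nonpos_of_not_alternatesFour {φ : ℝ → ℝ} (h : HasMoments φ) (h0 : ∫ t, φ t = 0)
    (h1 : ∫ t, t * φ t = 0) {n : ℕ} (hn : Even n) (h2 : ∫ t, t ^ (n + 2) * φ t = 0)
    (hφ : ¬ AlternatesFour φ) :
    ∫ t, t ^ (n + 3) * φ t ≤ 0 ∧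
      (∫ t, t ^ (n + 3) * φ t = 0 → ∀ x, primitiveIic φ x = 0) := by
  have hm0 := h.integral_pow_mul_primitiveIic_primitiveIic h0 h1 n
  have hm1 := h.integral_pow_mul_primitiveIic_primitiveIic h0 h1 (n + 1)
  have hM := (h.primitiveIic h0).primitiveIic (h.integral_primitiveIic h0 h1)
  have hc := continuous_primitiveIic (h.primitiveIic h0).integrable
  have hdone := primitiveIic_eq_zero_of_primitiveIic_primitiveIic h h0
  have hsign : ∀ u v, u < v → primitiveIic (primitiveIic φ) u < 0 →
      primitiveIic (primitiveIic φ) v ≤ 0 := fun u v huv hu =>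
    not_lt.mp fun hv => hφ (alternatesFour_of_primitiveIic h h0 h1 huv hu hv)
  set H := primitiveIic (primitiveIic φ)
  rw [h2] at hm0
  have hi0 : ∫ s, s ^ n * H s = 0 := by
    have : (n + 2 : ℝ) ≠ 0 := by positivity
    have : (n + 1 : ℝ) ≠ 0 := by positivity
    simp_all
  have hwn : ∀ x : ℝ, 0 ≤ x ^ n := fun x => hn.pow_nonneg x
  have hw0 : ∀ x ∉ ({0} : Set ℝ), x ^ n ≠ 0 := fun x hx => pow_ne_zero n hx
  have hconst : (∀ x, H x = 0) → ∫ t, t ^ (n + 3) * φ t ≤ 0 ∧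
      (∫ t, t ^ (n + 3) * φ t = 0 → ∀ x, primitiveIic φ x = 0) := by
    intro hH
    refine ⟨?_, fun _ => hdone hH⟩
    rw [← hm1]
    simp [hH]
  by_cases hne : ∃ u, 0 < H u
  · by_cases hbd : ∃ b, ∀ v, b < v → H v ≤ 0
    · obtain ⟨u, hu⟩ := hne
      obtain ⟨b, hb⟩ := hbd
      have hJ : BddAbove {x | 0 < H x} := ⟨b, fun v hv => not_lt.mp fun hlt =>
        absurd (hb v hlt) (not_le.mpr hv)⟩
      have hαl : ∀ x, x < sSup {x | 0 < H x} → 0 ≤ H x := by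
        intro x hx
        obtain ⟨v, hv, hxv⟩ := exists_lt_of_lt_csSup ⟨u, hu⟩ hx
        exact not_lt.mp fun hneg => absurd (hsign x v hxv hneg) (not_le.mpr hv)
      have hαr : ∀ x, sSup {x | 0 < H x} < x → H x ≤ 0 := fun x hx =>
        not_lt.mp fun hpos => absurd (le_csSup hJ hpos) (not_le.mpr hx)
      set α := sSup {x | 0 < H x}
      have hle : ∀ x, ((x - α) * x ^ n) * H x ≤ 0 := by
        intro x
        rw [mul_right_comm]
        refine mul_nonpos_of_nonpos_of_nonneg ?_ (hwn x)
        rcases lt_trichotomy x α with hx | hx | hx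
        · exact mul_nonpos_of_nonpos_of_nonneg (by linarith) (hαl x hx)
        · simp [hx]
        · exact mul_nonpos_of_nonneg_of_nonpos (by linarith) (hαr x hx)
      have hexp : (fun x => ((x - α) * x ^ n) * H x) =
          fun x => x ^ (n + 1) * H x - α * (x ^ n * H x) := by funext x; ring
      have hint : Integrable (fun x => ((x - α) * x ^ n) * H x) := by
        rw [hexp]; exact (hM (n + 1)).sub ((hM n).const_mul α)
      have hval : ∫ x, ((x - α) * x ^ n) * H x = ∫ x, x ^ (n + 1) * H x := by
        rw [hexp, integral_sub (hM (n + 1)) ((hM n).const_mul α), integral_const_mul, hi0]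
        ring
      have hnp : ∫ x, ((x - α) * x ^ n) * H x ≤ 0 := integral_nonpos hle
      push_cast at hm1
      rw [hval] at hnp
      refine ⟨?_, fun hz => ?_⟩
      · rw [← hm1]
        exact mul_nonpos_of_nonneg_of_nonpos (by positivity)
          (mul_nonpos_of_nonneg_of_nonpos (by positivity) hnp)
      · apply hdone
        rw [hz] at hm1
        have hz' : ∫ x, x ^ (n + 1) * H x = 0 := by
          have e1 : (n + 1 + 2 : ℝ) ≠ 0 := by positivity
          have e2 : (n + 1 + 1 : ℝ) ≠ 0 := by positivity
          exact (mul_eq_zero.mp ((mul_eq_zero.mp hm1).resolve_left e1)).resolve_left e2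
        refine eq_zero_of_mul_nonpos_of_integral_eq_zero hc (S := {α, 0}) (Set.toFinite _)
          (fun x hx => ?_) hint hle (hval.trans hz')
        simp only [Set.mem_insert_iff, Set.mem_singleton_iff, not_or] at hx
        exact mul_ne_zero (sub_ne_zero.mpr hx.1) (pow_ne_zero n hx.2)
    -- Positive values arbitrarily far to the right exclude negative ones everywhere, so the zero
    -- moment forces `H = 0`.
    · push Not at hbd
      refine hconst (eq_zero_of_mul_nonneg_of_integral_eq_zero hc (S := {0}) (Set.toFinite _) hw0
        (hM n) (fun x => mul_nonneg (hwn x) ?_) hi0)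
      obtain ⟨v, hv, hpos⟩ := hbd x
      exact not_lt.mp fun hneg => absurd (hsign x v hv hneg) (not_le.mpr hpos)
  · push Not at hne
    exact hconst (eq_zero_of_mul_nonpos_of_integral_eq_zero hc (S := {0}) (Set.toFinite _) hw0
      (hM n) (fun x => mul_nonpos_of_nonneg_of_nonpos (hwn x) (hne x)) hi0)

/-- Here `H` is nonnegative between any two points of positivity and nonpositive outside, so with
`α`, `β` the ends of that range `(x - α) * (x - β) * x^n * H x ≤ 0`. The two vanishing moments of
`H` leave only the leading term. -/
lemma moment_nonpos_of_not_alternatesFive {φ : ℝ → ℝ} (h : HasMoments φ) (h0 : ∫ t, φ t = 0)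
    (h1 : ∫ t, t * φ t = 0) {n : ℕ} (hn : Even n) (h2 : ∫ t, t ^ (n + 2) * φ t = 0)
    (h3 : ∫ t, t ^ (n + 3) * φ t = 0) (hφ : ¬ AlternatesFive φ) :
    ∫ t, t ^ (n + 4) * φ t ≤ 0 := by
  have hm0 := h.integral_pow_mul_primitiveIic_primitiveIic h0 h1 n
  have hm1 := h.integral_pow_mul_primitiveIic_primitiveIic h0 h1 (n + 1)
  have hm2 := h.integral_pow_mul_primitiveIic_primitiveIic h0 h1 (n + 2)
  have hM := (h.primitiveIic h0).primitiveIic (h.integral_primitiveIic h0 h1)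
  have hc := continuous_primitiveIic (h.primitiveIic h0).integrable
  have hsign : ∀ u v w, u < v → v < w → 0 < primitiveIic (primitiveIic φ) u →
      0 < primitiveIic (primitiveIic φ) w → 0 ≤ primitiveIic (primitiveIic φ) v :=
    fun u v w huv hvw hu hw =>
    not_lt.mp fun hv => hφ (alternatesFive_of_primitiveIic h h0 h1 huv hvw hu hv hw)
  set H := primitiveIic (primitiveIic φ)
  rw [h2] at hm0
  rw [h3] at hm1
  push_cast at hm1 hm2
  have hi0 : ∫ s, s ^ n * H s = 0 := by
    have e1 : (n + 2 : ℝ) ≠ 0 := by positivity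
    have e2 : (n + 1 : ℝ) ≠ 0 := by positivity
    exact (mul_eq_zero.mp ((mul_eq_zero.mp hm0).resolve_left e1)).resolve_left e2
  have hi1 : ∫ x, x ^ (n + 1) * H x = 0 := by
    have e1 : (n + 1 + 2 : ℝ) ≠ 0 := by positivity
    have e2 : (n + 1 + 1 : ℝ) ≠ 0 := by positivity
    exact (mul_eq_zero.mp ((mul_eq_zero.mp hm1).resolve_left e1)).resolve_left e2
  have hwn : ∀ x : ℝ, 0 ≤ x ^ n := fun x => hn.pow_nonneg x
  have hw0 : ∀ x ∉ ({0} : Set ℝ), x ^ n ≠ 0 := fun x hx => pow_ne_zero n hx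
  have hconst : (∀ x, H x = 0) → ∫ t, t ^ (n + 4) * φ t ≤ 0 := by
    intro hH
    rw [← hm2]
    simp [hH]
  have hexp : ∀ α, (fun x => ((x - α) * x ^ n) * H x) =
      fun x => x ^ (n + 1) * H x - α * (x ^ n * H x) := by intro α; funext x; ring
  have hint : ∀ α, Integrable (fun x => ((x - α) * x ^ n) * H x) := by
    intro α; rw [hexp]; exact (hM (n + 1)).sub ((hM n).const_mul α)
  have hval : ∀ α, ∫ x, ((x - α) * x ^ n) * H x = 0 := by
    intro α
    rw [hexp, integral_sub (hM (n + 1)) ((hM n).const_mul α), integral_const_mul, hi0, hi1]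
    ring
  have hlin : ∀ α, ∀ x ∉ ({α, 0} : Set ℝ), (x - α) * x ^ n ≠ 0 := by
    intro α x hx
    simp only [Set.mem_insert_iff, Set.mem_singleton_iff, not_or] at hx
    exact mul_ne_zero (sub_ne_zero.mpr hx.1) (pow_ne_zero n hx.2)
  set J := {x | 0 < H x}
  rcases J.eq_empty_or_nonempty with hJ | hJ
  · have hne : ∀ x, H x ≤ 0 := fun x => not_lt.mp fun hx => by
      have : x ∈ J := hx
      simp [hJ] at this
    exact hconst (eq_zero_of_mul_nonpos_of_integral_eq_zero hc (S := {0}) (Set.toFinite _) hw0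
      (hM n) (fun x => mul_nonpos_of_nonneg_of_nonpos (hwn x) (hne x)) hi0)
  have hmid : ∀ x, (∃ u ∈ J, u < x) → (∃ w ∈ J, x < w) → 0 ≤ H x :=
    fun x ⟨u, hu, hux⟩ ⟨w, hw, hxw⟩ => hsign u x w hux hxw hu hw
  have above : BddAbove J → ∀ x, sSup J < x → H x ≤ 0 := fun hb x hx =>
    not_lt.mp fun hpos => absurd (le_csSup hb hpos) (not_le.mpr hx)
  have below : BddBelow J → ∀ x, x < sInf J → H x ≤ 0 := fun hb x hx =>
    not_lt.mp fun hpos => absurd (csInf_le hb hpos) (not_le.mpr hx)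
  have bdd_or : ∀ x, ¬ BddAbove J → ∃ w ∈ J, x < w := fun x hb => not_bddAbove_iff.mp hb x
  have bdd_or' : ∀ x, ¬ BddBelow J → ∃ w ∈ J, w < x := fun x hb => not_bddBelow_iff.mp hb x
  by_cases ha : BddAbove J <;> by_cases hb : BddBelow J
  · set α := sInf J
    set β := sSup J
    have hαβ : α ≤ β := csInf_le_csSup hJ hb ha
    have hle : ∀ x, ((x - α) * (x - β) * x ^ n) * H x ≤ 0 := by
      intro x
      rw [mul_right_comm]
      refine mul_nonpos_of_nonpos_of_nonneg ?_ (hwn x)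
      rcases lt_trichotomy x α with hx | hx | hx
      · exact mul_nonpos_of_nonneg_of_nonpos
          (mul_nonneg_of_nonpos_of_nonpos (by linarith) (by linarith)) (below hb x hx)
      · simp [hx]
      · rcases lt_trichotomy x β with hx' | hx' | hx'
        · refine mul_nonpos_of_nonpos_of_nonneg
            (mul_nonpos_of_nonneg_of_nonpos (by linarith) (by linarith)) (hmid x ?_ ?_)
          · exact exists_lt_of_csInf_lt hJ hx
          · exact exists_lt_of_lt_csSup hJ hx'
        · simp [hx']
        · exact mul_nonpos_of_nonneg_of_nonpos (mul_nonneg (by linarith) (by linarith))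
            (above ha x hx')
    have hexp2 : (fun x => ((x - α) * (x - β) * x ^ n) * H x) =
        fun x => x ^ (n + 2) * H x - (α + β) * (x ^ (n + 1) * H x) + α * β * (x ^ n * H x) := by
      funext x; ring
    have hnp : ∫ x, ((x - α) * (x - β) * x ^ n) * H x ≤ 0 := integral_nonpos hle
    have hsub : Integrable fun x => x ^ (n + 2) * H x - (α + β) * (x ^ (n + 1) * H x) :=
      (hM (n + 2)).sub ((hM (n + 1)).const_mul _)
    rw [hexp2, integral_add hsub ((hM n).const_mul _),
      integral_sub (hM (n + 2)) ((hM (n + 1)).const_mul _), integral_const_mul, integral_const_mul,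
      hi0, hi1, mul_zero, mul_zero, sub_zero, add_zero] at hnp
    rw [← hm2]
    exact mul_nonpos_of_nonneg_of_nonpos (by positivity)
      (mul_nonpos_of_nonneg_of_nonpos (by positivity) hnp)
  -- If an end of the range is infinite, a weight with at most one linear factor already matches the
  -- sign of `H`, and the vanishing moments give `H = 0`.
  · refine hconst (eq_zero_of_mul_nonpos_of_integral_eq_zero hc (S := {sSup J, 0})
      (Set.toFinite _) (hlin _) (hint _) (fun x => ?_) (hval _))
    rw [mul_right_comm]
    refine mul_nonpos_of_nonpos_of_nonneg ?_ (hwn x)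
    rcases lt_trichotomy x (sSup J) with hx | hx | hx
    · exact mul_nonpos_of_nonpos_of_nonneg (by linarith)
        (hmid x (bdd_or' x hb) (exists_lt_of_lt_csSup hJ hx))
    · simp [hx]
    · exact mul_nonpos_of_nonneg_of_nonpos (by linarith) (above ha x hx)
  · refine hconst (eq_zero_of_mul_nonneg_of_integral_eq_zero hc (S := {sInf J, 0})
      (Set.toFinite _) (hlin _) (hint _) (fun x => ?_) (hval _))
    rw [mul_right_comm]
    refine mul_nonneg ?_ (hwn x)
    rcases lt_trichotomy x (sInf J) with hx | hx | hx
    · exact mul_nonneg_of_nonpos_of_nonpos (by linarith) (below hb x hx)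
    · simp [hx]
    · exact mul_nonneg (by linarith) (hmid x (exists_lt_of_csInf_lt hJ hx) (bdd_or x ha))
  · exact hconst (eq_zero_of_mul_nonneg_of_integral_eq_zero hc (S := {0}) (Set.toFinite _) hw0
      (hM n) (fun x => mul_nonneg (hwn x) (hmid x (bdd_or' x hb) (bdd_or x ha))) hi0)

/-! ### Densities and moments of exponential and asymmetric Laplace laws. -/

lemma integral_pow_mul_exp_neg_div {a : ℝ} (ha : 0 < a) (j : ℕ) :
    ∫ y in Set.Ioi (0 : ℝ), y ^ j * Real.exp (-(y / a)) = j.factorial * a ^ (j + 1) := by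
  have h := Real.integral_rpow_mul_exp_neg_mul_Ioi (a := j + 1) (r := 1 / a) (by positivity)
    (by positivity)
  rw [Real.Gamma_nat_eq_factorial, one_div_one_div] at h
  have h2 : a ^ ((j : ℝ) + 1) = a ^ (j + 1) := by exact_mod_cast Real.rpow_natCast a (j + 1)
  rw [h2] at h
  rw [mul_comm, ← h]
  refine setIntegral_congr_fun measurableSet_Ioi fun y hy => ?_
  simp only [add_sub_cancel_right, Real.rpow_natCast]
  congr 3
  ring

lemma integrableOn_pow_mul_exp_neg_div {a : ℝ} (ha : 0 < a) (j : ℕ) :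
    IntegrableOn (fun y => y ^ j * Real.exp (-(y / a))) (Set.Ioi (0 : ℝ)) := by
  refine Integrable.of_integral_ne_zero ?_
  rw [integral_pow_mul_exp_neg_div ha j]
  positivity

/-- The function `e^{-y / a}` on `[0, ∞)`, extended by zero. -/
noncomputable def expTail (a y : ℝ) : ℝ := if 0 ≤ y then Real.exp (-(y / a)) else 0

lemma pow_mul_expTail (a : ℝ) (j : ℕ) : (fun y => y ^ j * expTail a y) =
    (Set.Ici (0 : ℝ)).indicator (fun y => y ^ j * Real.exp (-(y / a))) := by
  funext y
  unfold expTail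
  by_cases h : 0 ≤ y <;> simp [h]

lemma hasMoments_expTail {a : ℝ} (ha : 0 < a) : HasMoments (expTail a) := by
  intro j
  rw [pow_mul_expTail, integrable_indicator_iff measurableSet_Ici, integrableOn_Ici_iff_integrableOn_Ioi]
  exact integrableOn_pow_mul_exp_neg_div ha j

lemma integral_pow_mul_expTail {a : ℝ} (ha : 0 < a) (j : ℕ) :
    ∫ y, y ^ j * expTail a y = j.factorial * a ^ (j + 1) := by
  rw [pow_mul_expTail, integral_indicator measurableSet_Ici, integral_Ici_eq_integral_Ioi,
    integral_pow_mul_exp_neg_div ha j]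

lemma pow_mul_comp_neg (K : ℝ → ℝ) (j : ℕ) : (fun y => y ^ j * K (-y)) =
    fun y => (fun x => (-1) ^ j * (x ^ j * K x)) (-y) := by
  funext y
  simp only [neg_pow y, ← mul_assoc, ← mul_pow]
  simp

lemma HasMoments.comp_neg {K : ℝ → ℝ} (h : HasMoments K) : HasMoments fun y => K (-y) := by
  intro j
  rw [pow_mul_comp_neg]
  exact ((h j).const_mul _).comp_neg

lemma integral_pow_mul_comp_neg (K : ℝ → ℝ) (j : ℕ) :
    ∫ y, y ^ j * K (-y) = (-1) ^ j * ∫ y, y ^ j * K y := by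
  rw [pow_mul_comp_neg, integral_neg_eq_self (fun x => (-1) ^ j * (x ^ j * K x)),
    integral_const_mul]

lemma HasMoments.congr_ae {K K' : ℝ → ℝ} (h : HasMoments K) (hK : K =ᵐ[volume] K') :
    HasMoments K' := fun j => (h j).congr (by filter_upwards [hK] with x hx; rw [hx])

lemma HasMoments.add {K K' : ℝ → ℝ} (h : HasMoments K) (h' : HasMoments K') :
    HasMoments fun x => K x + K' x := fun j => by
  simp only [mul_add]; exact (h j).add (h' j)

lemma HasMoments.sub {K K' : ℝ → ℝ} (h : HasMoments K) (h' : HasMoments K') :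
    HasMoments fun x => K x - K' x := fun j => by
  simp only [mul_sub]; exact (h j).sub (h' j)

/-- The two-sided exponential `e^{-y / a}` on `[0, ∞)` and `e^{y / b}` on `(-∞, 0)`. -/
noncomputable def twoSidedExp (a b y : ℝ) : ℝ :=
  if 0 ≤ y then Real.exp (-(y / a)) else Real.exp (y / b)

lemma twoSidedExp_ae_eq (a b : ℝ) :
    (fun y => expTail a y + expTail b (-y)) =ᵐ[volume] twoSidedExp a b := by
  filter_upwards [compl_mem_ae_iff.mpr (measure_singleton (μ := volume) (0 : ℝ))] with y hy
  simp only [Set.mem_compl_iff, Set.mem_singleton_iff] at hy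
  unfold expTail twoSidedExp
  by_cases h : 0 ≤ y
  · have : ¬ y ≤ 0 := fun h2 => hy (le_antisymm h2 h)
    simp [h, this]
  · have : y ≤ 0 := by linarith
    simp [h, this, neg_div]

lemma hasMoments_twoSidedExp {a b : ℝ} (ha : 0 < a) (hb : 0 < b) :
    HasMoments (twoSidedExp a b) :=
  ((hasMoments_expTail ha).add (hasMoments_expTail hb).comp_neg).congr_ae (twoSidedExp_ae_eq a b)

lemma integral_pow_mul_twoSidedExp {a b : ℝ} (ha : 0 < a) (hb : 0 < b) (j : ℕ) :
    ∫ y, y ^ j * twoSidedExp a b y = j.factorial * (a ^ (j + 1) - (-b) ^ (j + 1)) := by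
  have h : ∫ y, y ^ j * twoSidedExp a b y =
      ∫ y, (y ^ j * expTail a y + y ^ j * expTail b (-y)) := by
    refine integral_congr_ae ?_
    filter_upwards [twoSidedExp_ae_eq a b] with y hy
    rw [← hy, mul_add]
  rw [h, integral_add (hasMoments_expTail ha j) ((hasMoments_expTail hb).comp_neg j),
    integral_pow_mul_comp_neg, integral_pow_mul_expTail ha, integral_pow_mul_expTail hb,
    neg_pow b, pow_succ (-1 : ℝ) j]
  ring

lemma asymLaplaceMoment_eq_sum_choose (k : ℕ) (a b : ℝ) :
    asymLaplaceMoment k a b = (∑ j ∈ Finset.range (k + 1), (b - a) ^ (k - j) * k.choose j *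
      (j.factorial * (a ^ (j + 1) - (-b) ^ (j + 1)))) / (a + b) := by
  unfold asymLaplaceMoment
  rw [Finset.mul_sum, ← Finset.sum_range_reflect]
  congr 1
  refine Finset.sum_congr rfl fun j hj => ?_
  have hj' : j ≤ k := Nat.lt_succ_iff.mp (Finset.mem_range.mp hj)
  rw [show k + 1 - 1 - j = k - j by omega, show k + 1 - (k - j) = j + 1 by omega]
  have h1 : (k.factorial : ℝ) = k.choose j * j.factorial * (k - j).factorial := by
    exact_mod_cast (Nat.choose_mul_factorial_mul_factorial hj').symm
  rw [h1]
  have : ((k - j).factorial : ℝ) ≠ 0 := by positivity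
  field_simp

lemma pow_mul_comp_sub_div (K : ℝ → ℝ) (a b : ℝ) (k : ℕ) :
    (fun x => x ^ k * (K (x - (b - a)) / (a + b))) = fun x =>
      (fun y => ∑ j ∈ Finset.range (k + 1),
        (b - a) ^ (k - j) * k.choose j / (a + b) * (y ^ j * K y)) (x - (b - a)) := by
  funext x
  simp only
  conv_lhs => rw [show x = (x - (b - a)) + (b - a) by ring, add_pow]
  rw [Finset.sum_mul]
  refine Finset.sum_congr rfl fun j _ => ?_
  rw [show x - (b - a) + (b - a) - (b - a) = x - (b - a) by ring]
  ring

lemma hasMoments_comp_sub_div {K : ℝ → ℝ} (hK : HasMoments K) (a b : ℝ) :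
    HasMoments fun x => K (x - (b - a)) / (a + b) := by
  intro k
  rw [pow_mul_comp_sub_div]
  exact (integrable_finsetSum _ fun j _ => (hK j).const_mul _).comp_sub_right (b - a)

/-- The shift by `b - a` cancels the mean of the two-sided exponential; the binomial formula expands
it. No positivity of `b` is required, so `b = 0` covers the exponential law. -/
lemma integral_pow_mul_comp_sub_div {K : ℝ → ℝ} (hK : HasMoments K) {a b : ℝ}
    (hm : ∀ j, ∫ y, y ^ j * K y = j.factorial * (a ^ (j + 1) - (-b) ^ (j + 1))) (k : ℕ) :
    ∫ x, x ^ k * (K (x - (b - a)) / (a + b)) = asymLaplaceMoment k a b := by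
  rw [pow_mul_comp_sub_div, integral_sub_right_eq_self (fun y => ∑ j ∈ Finset.range (k + 1),
      (b - a) ^ (k - j) * k.choose j / (a + b) * (y ^ j * K y)), integral_finsetSum _ fun j _ => (hK j).const_mul _,
    asymLaplaceMoment_eq_sum_choose, Finset.sum_div]
  refine Finset.sum_congr rfl fun j _ => ?_
  rw [integral_const_mul, hm]
  ring

/-- The density of the centered asymmetric Laplace law with scales `a` and `b`. -/
noncomputable def asymLaplacePDF (a b x : ℝ) : ℝ := twoSidedExp a b (x - (b - a)) / (a + b)

/-- The density of the centered exponential law with scale `a`. -/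
noncomputable def scaledExpPDF (a x : ℝ) : ℝ := expTail a (x + a) / a

lemma scaledExpPDF_eq (a : ℝ) :
    scaledExpPDF a = fun x => expTail a (x - (0 - a)) / (a + 0) := by
  funext x
  unfold scaledExpPDF
  rw [show x - (0 - a) = x + a by ring, add_zero]

lemma hasMoments_asymLaplacePDF {a b : ℝ} (ha : 0 < a) (hb : 0 < b) :
    HasMoments (asymLaplacePDF a b) := hasMoments_comp_sub_div (hasMoments_twoSidedExp ha hb) a b

lemma integral_pow_mul_asymLaplacePDF {a b : ℝ} (ha : 0 < a) (hb : 0 < b) (k : ℕ) :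
    ∫ x, x ^ k * asymLaplacePDF a b x = asymLaplaceMoment k a b :=
  integral_pow_mul_comp_sub_div (hasMoments_twoSidedExp ha hb)
    (integral_pow_mul_twoSidedExp ha hb) k

lemma hasMoments_scaledExpPDF {a : ℝ} (ha : 0 < a) : HasMoments (scaledExpPDF a) := by
  rw [scaledExpPDF_eq]
  exact hasMoments_comp_sub_div (hasMoments_expTail ha) a 0

lemma integral_pow_mul_scaledExpPDF {a : ℝ} (ha : 0 < a) (k : ℕ) :
    ∫ x, x ^ k * scaledExpPDF a x = a ^ k * numDerangements k := by
  rw [scaledExpPDF_eq, ← asymLaplaceMoment_zero_right k ha.ne']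
  refine integral_pow_mul_comp_sub_div (hasMoments_expTail ha) (fun j => ?_) k
  rw [integral_pow_mul_expTail ha, neg_zero, zero_pow (by omega), sub_zero]

lemma asymLaplaceMoment_zero_left_order {a b : ℝ} (hab : a + b ≠ 0) :
    asymLaplaceMoment 0 a b = 1 := by
  simp [asymLaplaceMoment, hab]

lemma asymLaplaceMoment_first_order (a b : ℝ) : asymLaplaceMoment 1 a b = 0 := by
  simp only [asymLaplaceMoment, Finset.sum_range_succ, Finset.sum_range_zero]
  norm_num
  left
  ring

/-! ### Log-concave densities: tails and crossings. -/

/-- `f` is a probability density on `ℝ` which is log-concave on its support. -/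
structure IsLogConcavePDF (f : ℝ → ℝ) : Prop where
  measurable : Measurable f
  nonneg : ∀ x, 0 ≤ f x
  integrable : Integrable f
  integral_eq_one : ∫ x, f x = 1
  concaveOn : ConcaveOn ℝ (Function.support f) (fun x => Real.log (f x))

namespace IsLogConcavePDF

variable {f : ℝ → ℝ}

lemma comp_neg (hf : IsLogConcavePDF f) : IsLogConcavePDF fun x => f (-x) where
  measurable := hf.measurable.comp measurable_neg
  nonneg x := hf.nonneg (-x)
  integrable := hf.integrable.comp_neg
  integral_eq_one := by rw [integral_neg_eq_self f]; exact hf.integral_eq_one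
  concaveOn := by
    refine ⟨?_, ?_⟩
    · intro x hx y hy a b ha hb hab
      have := hf.concaveOn.1 (x := -x) (y := -y) hx hy ha hb hab
      simp only [Function.mem_support, smul_eq_mul] at this ⊢
      convert this using 2
      ring
    · intro x hx y hy a b ha hb hab
      have := hf.concaveOn.2 (x := -x) (y := -y) hx hy ha hb hab
      simp only [smul_eq_mul] at this ⊢
      convert this using 3
      ring

/-- A log-concave function that is above a log-affine function at two points is above it in
between. -/
lemma exp_lt (hf : IsLogConcavePDF f) {c s x y z : ℝ} (hxy : x < y) (hyz : y < z)
    (hx : Real.exp (c + s * x) < f x) (hz : Real.exp (c + s * z) < f z) :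
    Real.exp (c + s * y) < f y := by
  have hx0 : 0 < f x := (Real.exp_pos _).trans hx
  have hz0 : 0 < f z := (Real.exp_pos _).trans hz
  have hzx : 0 < z - x := by linarith
  have ha : 0 < (z - y) / (z - x) := div_pos (by linarith) hzx
  have hb : 0 < (y - x) / (z - x) := div_pos (by linarith) hzx
  have hab : (z - y) / (z - x) + (y - x) / (z - x) = 1 := by field_simp; ring
  have hy : (z - y) / (z - x) * x + (y - x) / (z - x) * z = y := by field_simp; ring
  have h1 := hf.concaveOn.1 (x := x) (y := z) hx0.ne' hz0.ne' ha.le hb.le hab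
  have h2 := hf.concaveOn.2 (x := x) (y := z) hx0.ne' hz0.ne' ha.le hb.le hab
  simp only [smul_eq_mul, hy] at h1 h2
  have hy0 : 0 < f y := lt_of_le_of_ne (hf.nonneg y) (Ne.symm h1)
  rw [← Real.lt_log_iff_exp_lt hx0] at hx
  rw [← Real.lt_log_iff_exp_lt hz0] at hz
  rw [← Real.lt_log_iff_exp_lt hy0]
  set α := (z - y) / (z - x)
  set β := (y - x) / (z - x)
  have h3 := mul_lt_mul_of_pos_left hx ha
  have h4 := mul_lt_mul_of_pos_left hz hb
  calc c + s * y = α * (c + s * x) + β * (c + s * z) := by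
        rw [← hy]; linear_combination (-c) * hab
    _ < _ := by linarith

lemma exists_pos (hf : IsLogConcavePDF f) : ∃ x, 0 < f x := by
  by_contra! H
  have : f = fun _ => 0 := funext fun x => le_antisymm (H x) (hf.nonneg x)
  have h := hf.integral_eq_one
  simp [this] at h

/-- Otherwise `f` would be nondecreasing, hence above a positive constant on a half-line. -/
lemma exists_lt (hf : IsLogConcavePDF f) : ∃ x y, x < y ∧ f y < f x := by
  by_contra! H
  obtain ⟨x, hx⟩ := hf.exists_pos
  have h1 : IntegrableOn (fun _ => f x) (Set.Ioi x) := by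
    refine Integrable.mono' hf.integrable.integrableOn (by fun_prop) ?_
    filter_upwards [ae_restrict_mem measurableSet_Ioi] with y hy
    rw [Real.norm_of_nonneg hx.le]
    exact H x y hy
  rw [integrableOn_const_iff] at h1
  rcases h1 with h1 | h1
  · exact hx.ne' (by simpa using h1)
  · simp at h1

/-- Take a decreasing log-affine function lying below `f` at `x` and above it at `y > x`. Rising to
it again past `y` would contradict `exp_lt`, so it bounds the tail. -/
lemma exists_exp_bound (hf : IsLogConcavePDF f) :
    ∃ c s R, 0 < s ∧ 0 ≤ R ∧ ∀ x, R ≤ x → f x ≤ Real.exp (c - s * x) := by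
  obtain ⟨x, y, hxy, hlt⟩ := hf.exists_lt
  obtain ⟨v₀, h1, h2⟩ := exists_between hlt
  obtain ⟨v₁, h3, h4⟩ := exists_between h1
  have hv1 : 0 < v₁ := (hf.nonneg y).trans_lt h3
  have hv0 : 0 < v₀ := hv1.trans h4
  have hyx : 0 < y - x := by linarith
  have hlog : Real.log v₁ < Real.log v₀ := Real.log_lt_log hv1 h4
  set s := (Real.log v₀ - Real.log v₁) / (y - x) with hs
  have hs0 : 0 < s := div_pos (by linarith) hyx
  have hsyx : s * (y - x) = Real.log v₀ - Real.log v₁ := by rw [hs]; field_simp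
  refine ⟨Real.log v₀ + s * x, s, max 0 (y + 1), hs0, le_max_left _ _, fun z hz => ?_⟩
  have hyz : y < z := by linarith [(le_max_right 0 (y + 1)).trans hz]
  by_contra! hcon
  have := hf.exp_lt (c := Real.log v₀ + s * x) (s := -s) hxy hyz
    (by rw [show Real.log v₀ + s * x + -s * x = Real.log v₀ by ring, Real.exp_log hv0]; exact h2)
    (by rw [show Real.log v₀ + s * x + -s * z = Real.log v₀ + s * x - s * z by ring]; exact hcon)
  rw [show Real.log v₀ + s * x + -s * y = Real.log v₁ by linarith, Real.exp_log hv1] at this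
  linarith

lemma hasMoments (hf : IsLogConcavePDF f) : HasMoments f := by
  obtain ⟨c, s, R, hs, hR, hb⟩ := hf.exists_exp_bound
  obtain ⟨c', s', R', hs', hR', hb'⟩ := hf.comp_neg.exists_exp_bound
  intro k
  -- Dominating functions: an exponential for each tail and a multiple of `f` itself for the bounded
  -- middle range.
  have hd1 := ((hasMoments_expTail (a := 1 / s) (by positivity) k).norm).const_mul (Real.exp c)
  have hd2 := (((hasMoments_expTail (a := 1 / s') (by positivity)).comp_neg k).norm).const_mul
    (Real.exp c')
  have hd3 := hf.integrable.const_mul (max R R' ^ k)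
  refine Integrable.mono' ((hd3.add hd1).add hd2)
    ((measurable_id.pow_const k).mul hf.measurable).aestronglyMeasurable
    (Filter.Eventually.of_forall fun x => ?_)
  simp only [Pi.add_apply]
  have hmax : 0 ≤ max R R' := le_max_of_le_left hR
  have hA : 0 ≤ max R R' ^ k * f x := mul_nonneg (by positivity) (hf.nonneg x)
  have hB : 0 ≤ Real.exp c * ‖x ^ k * expTail (1 / s) x‖ := by positivity
  have hC : 0 ≤ Real.exp c' * ‖x ^ k * expTail (1 / s') (-x)‖ := by positivity
  rw [norm_mul, Real.norm_of_nonneg (hf.nonneg x)]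
  rcases le_or_gt R x with h1 | h1
  · have hx0 : 0 ≤ x := hR.trans h1
    have h2 : ‖x ^ k‖ * f x ≤ Real.exp c * ‖x ^ k * expTail (1 / s) x‖ := by
      rw [norm_mul, mul_left_comm]
      refine mul_le_mul_of_nonneg_left ((hb x h1).trans (le_of_eq ?_)) (norm_nonneg _)
      rw [expTail, if_pos hx0, Real.norm_of_nonneg (Real.exp_pos _).le, ← Real.exp_add]
      congr 1
      field_simp
      ring
    linarith
  rcases le_or_gt R' (-x) with h3 | h3
  · have hx0 : 0 ≤ -x := hR'.trans h3
    have h4 := hb' (-x) h3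
    rw [neg_neg] at h4
    have h2 : ‖x ^ k‖ * f x ≤ Real.exp c' * ‖x ^ k * expTail (1 / s') (-x)‖ := by
      rw [norm_mul, mul_left_comm]
      refine mul_le_mul_of_nonneg_left (h4.trans (le_of_eq ?_)) (norm_nonneg _)
      rw [expTail, if_pos hx0, Real.norm_of_nonneg (Real.exp_pos _).le, ← Real.exp_add]
      congr 1
      field_simp
      ring
    linarith
  have h2 : ‖x ^ k‖ * f x ≤ max R R' ^ k * f x := by
    refine mul_le_mul_of_nonneg_right ?_ (hf.nonneg x)
    rw [norm_pow]
    refine pow_le_pow_left₀ (norm_nonneg _) ?_ k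
    rw [Real.norm_eq_abs, abs_le]
    have := le_max_left R R'
    have := le_max_right R R'
    constructor <;> linarith
  linarith

/-- The first negative value can only occur where the exponential density is positive. To its right
that density is log-affine, so the remaining pattern `+ - +` contradicts log-concavity. -/
lemma not_alternatesFour_sub_scaledExpPDF (hf : IsLogConcavePDF f) {a : ℝ} (ha : 0 < a) :
    ¬ AlternatesFour fun x => f x - scaledExpPDF a x := by
  rintro ⟨p₁, p₂, p₃, p₄, h12, h23, h34, h1, h2, h3, h4⟩
  have hp : -a ≤ p₁ := by
    by_contra hp
    have : scaledExpPDF a p₁ = 0 := by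
      rw [scaledExpPDF, expTail, if_neg (by linarith), zero_div]
    simp only [this] at h1
    linarith [hf.nonneg p₁]
  have hg : ∀ x, -a ≤ x → scaledExpPDF a x = Real.exp ((-1 - Real.log a) + (-1 / a) * x) := by
    intro x hx
    rw [scaledExpPDF, expTail, if_pos (by linarith),
      show (-1 - Real.log a) + (-1 / a) * x = -((x + a) / a) - Real.log a by field_simp; ring,
      Real.exp_sub, Real.exp_log ha]
  simp only [hg p₂ (by linarith), hg p₃ (by linarith), hg p₄ (by linarith)] at h2 h3 h4
  have := hf.exp_lt h23 h34 (by linarith) (by linarith)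
  linarith

/-- Wherever the middle point lies, three consecutive points with signs `+ - +` are on one side of
the peak `b - a`, where the Laplace density is log-affine. -/
lemma not_alternatesFive_sub_asymLaplacePDF (hf : IsLogConcavePDF f) {a b : ℝ}
    (ha : 0 < a) (hb : 0 < b) : ¬ AlternatesFive fun x => f x - asymLaplacePDF a b x := by
  rintro ⟨p₁, p₂, p₃, p₄, p₅, h12, h23, h34, h45, h1, h2, h3, h4, h5⟩
  have hab : 0 < a + b := by linarith
  have hr : ∀ x, b - a ≤ x → asymLaplacePDF a b x =
      Real.exp (((b - a) / a - Real.log (a + b)) + (-1 / a) * x) := by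
    intro x hx
    rw [asymLaplacePDF, twoSidedExp, if_pos (by linarith),
      show ((b - a) / a - Real.log (a + b)) + (-1 / a) * x =
        -((x - (b - a)) / a) - Real.log (a + b) by field_simp; ring, Real.exp_sub, Real.exp_log hab]
  have hl : ∀ x, x ≤ b - a → asymLaplacePDF a b x =
      Real.exp ((-(b - a) / b - Real.log (a + b)) + (1 / b) * x) := by
    intro x hx
    have h : twoSidedExp a b (x - (b - a)) = Real.exp ((x - (b - a)) / b) := by
      rcases hx.lt_or_eq with h | h
      · rw [twoSidedExp, if_neg (by linarith)]
      · rw [h]; simp [twoSidedExp]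
    rw [asymLaplacePDF, h, show (-(b - a) / b - Real.log (a + b)) + (1 / b) * x =
        ((x - (b - a)) / b) - Real.log (a + b) by field_simp; ring, Real.exp_sub, Real.exp_log hab]
  rcases le_total (b - a) p₃ with hp | hp
  · simp only [hr p₃ hp, hr p₄ (by linarith), hr p₅ (by linarith)] at h3 h4 h5
    have := hf.exp_lt h34 h45 (by linarith) (by linarith)
    linarith
  · simp only [hl p₃ hp, hl p₂ (by linarith), hl p₁ (by linarith)] at h1 h2 h3
    have := hf.exp_lt h12 h23 (by linarith) (by linarith)
    linarith

end IsLogConcavePDF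

/-! ### Comparison of consecutive even moments. -/

lemma integral_even_pow_mul_pos {g : ℝ → ℝ} (hg : HasMoments g) (h0 : ∀ x, 0 ≤ g x)
    (h1 : ∫ x, g x = 1) {n : ℕ} (hn : Even n) : 0 < ∫ x, x ^ n * g x := by
  have hnn : ∀ x, 0 ≤ x ^ n * g x := fun x => mul_nonneg (hn.pow_nonneg x) (h0 x)
  refine lt_of_le_of_ne (integral_nonneg hnn) fun h => ?_
  have h2 := (integral_eq_zero_iff_of_nonneg hnn (hg n)).mp h.symm
  have h3 : g =ᵐ[volume] fun _ => 0 := by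
    filter_upwards [h2, compl_mem_ae_iff.mpr (measure_singleton (μ := volume) (0 : ℝ))] with x hx hx0
    exact (mul_eq_zero.mp hx).resolve_left (pow_ne_zero n hx0)
  rw [integral_congr_ae h3] at h1
  simp at h1

lemma withDensity_eq_of_primitiveIic_sub_eq_zero {f g : ℝ → ℝ} (hf : Integrable f)
    (hg : Integrable g) (hf0 : ∀ x, 0 ≤ f x) (hg0 : ∀ x, 0 ≤ g x)
    (h : ∀ x, primitiveIic (fun t => f t - g t) x = 0) :
    volume.withDensity (fun x => ENNReal.ofReal (f x)) =
      volume.withDensity (fun x => ENNReal.ofReal (g x)) := by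
  have := isFiniteMeasure_withDensity_ofReal hf.hasFiniteIntegral
  have := isFiniteMeasure_withDensity_ofReal hg.hasFiniteIntegral
  refine Measure.ext_of_Iic _ _ fun x => ?_
  rw [withDensity_apply _ measurableSet_Iic, withDensity_apply _ measurableSet_Iic,
    ← ofReal_integral_eq_lintegral_ofReal hf.integrableOn (Filter.Eventually.of_forall hf0),
    ← ofReal_integral_eq_lintegral_ofReal hg.integrableOn (Filter.Eventually.of_forall hg0)]
  have h1 := h x
  rw [primitiveIic, integral_sub hf.integrableOn hg.integrableOn] at h1
  rw [sub_eq_zero.mp h1]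

lemma scaledExpPDF_nonneg {a : ℝ} (ha : 0 < a) (x : ℝ) : 0 ≤ scaledExpPDF a x := by
  unfold scaledExpPDF expTail
  split_ifs <;> positivity

lemma asymLaplacePDF_nonneg {a b : ℝ} (ha : 0 < a) (hb : 0 < b) (x : ℝ) :
    0 ≤ asymLaplacePDF a b x := by
  unfold asymLaplacePDF twoSidedExp
  split_ifs <;> positivity

lemma HasMoments.integral_pow_mul_sub {f g : ℝ → ℝ} (hf : HasMoments f) (hg : HasMoments g)
    (k : ℕ) : ∫ x, x ^ k * (f x - g x) = (∫ x, x ^ k * f x) - ∫ x, x ^ k * g x := by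
  simp only [mul_sub]
  exact integral_sub (hf k) (hg k)

namespace IsLogConcavePDF

variable {f : ℝ → ℝ}

lemma odd_moment_le (hf : IsLogConcavePDF f) (hf1 : ∫ x, x * f x = 0) {n : ℕ} (hn : Even n)
    (hn2 : 2 ≤ n) {a : ℝ} (ha : 0 < a) (hm : ∫ x, x ^ n * f x = a ^ n * numDerangements n) :
    ∫ x, x ^ (n + 1) * f x ≤ a ^ (n + 1) * numDerangements (n + 1) ∧
      (∫ x, x ^ (n + 1) * f x = a ^ (n + 1) * numDerangements (n + 1) →
        volume.withDensity (fun x => ENNReal.ofReal (f x)) =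
          volume.withDensity (fun x => ENNReal.ofReal (scaledExpPDF a x))) := by
  obtain ⟨m, rfl⟩ := Nat.exists_eq_add_of_le' hn2
  have hm' : Even m := by simpa [Nat.even_add] using hn
  have hF := hf.hasMoments
  have hG := hasMoments_scaledExpPDF ha
  have hs := hF.integral_pow_mul_sub hG
  simp only [integral_pow_mul_scaledExpPDF ha] at hs
  have h0 : ∫ x, (f x - scaledExpPDF a x) = 0 := by
    have := hs 0
    simpa [hf.integral_eq_one] using this
  have h1 : ∫ x, x * (f x - scaledExpPDF a x) = 0 := by
    have := hs 1
    simpa [hf1] using this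
  have h2 := hs (m + 2)
  rw [hm, sub_self] at h2
  have key := moment_nonpos_of_not_alternatesFour (hF.sub hG) h0 h1 hm' h2
    (hf.not_alternatesFour_sub_scaledExpPDF ha)
  rw [hs (m + 3)] at key
  refine ⟨by linarith [key.1], fun he => ?_⟩
  exact withDensity_eq_of_primitiveIic_sub_eq_zero hf.integrable hG.integrable hf.nonneg
    (scaledExpPDF_nonneg ha) (key.2 (by linarith))

lemma moment_le_asymLaplaceMoment (hf : IsLogConcavePDF f) (hf1 : ∫ x, x * f x = 0) {n : ℕ}
    (hn : Even n) (hn2 : 2 ≤ n) {a b : ℝ} (ha : 0 < a) (hb : 0 < b)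
    (hm : ∫ x, x ^ n * f x = asymLaplaceMoment n a b)
    (hm1 : ∫ x, x ^ (n + 1) * f x = asymLaplaceMoment (n + 1) a b) :
    ∫ x, x ^ (n + 2) * f x ≤ asymLaplaceMoment (n + 2) a b := by
  obtain ⟨m, rfl⟩ := Nat.exists_eq_add_of_le' hn2
  have hm' : Even m := by simpa [Nat.even_add] using hn
  have hF := hf.hasMoments
  have hG := hasMoments_asymLaplacePDF ha hb
  have hs := hF.integral_pow_mul_sub hG
  simp only [integral_pow_mul_asymLaplacePDF ha hb] at hs
  have h0 : ∫ x, (f x - asymLaplacePDF a b x) = 0 := by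
    have := hs 0
    rw [asymLaplaceMoment_zero_left_order (by positivity)] at this
    simpa [hf.integral_eq_one] using this
  have h1 : ∫ x, x * (f x - asymLaplacePDF a b x) = 0 := by
    have := hs 1
    rw [asymLaplaceMoment_first_order] at this
    simpa [hf1] using this
  have h2 := hs (m + 2)
  rw [hm, sub_self] at h2
  have h3 := hs (m + 3)
  rw [hm1, sub_self] at h3
  have key := moment_nonpos_of_not_alternatesFive (hF.sub hG) h0 h1 hm' h2 h3
    (hf.not_alternatesFive_sub_asymLaplacePDF ha hb)
  rw [hs (m + 4)] at key
  linarith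

end IsLogConcavePDF

lemma asymLaplaceMoment_even_pos {a b : ℝ} (ha : 0 < a) (hb : 0 < b) {n : ℕ} (hn : Even n) :
    0 < asymLaplaceMoment n a b := by
  have h := hasMoments_asymLaplacePDF ha hb
  have h1 := integral_pow_mul_asymLaplacePDF ha hb 0
  rw [asymLaplaceMoment_zero_left_order (by positivity)] at h1
  rw [← integral_pow_mul_asymLaplacePDF ha hb n]
  exact integral_even_pow_mul_pos h (asymLaplacePDF_nonneg ha hb) (by simpa using h1) hn

/-- Move along the scales `(1 - θ, θ)`, rescaled by `s θ` so that the `n`-th moment stays fixed. The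
odd moment varies continuously from one exponential extreme at `θ = 0` to its reflection at `θ = 1`.
The strict bounds on `ν` keep `θ` inside, so both scales are positive. -/
lemma exists_asymLaplaceMoment_eq {n : ℕ} (hn : Even n) (hn2 : 2 ≤ n) {c ν : ℝ} (hc : 0 < c)
    (hν : ν < c ^ (n + 1) * numDerangements (n + 1))
    (hν' : -(c ^ (n + 1) * numDerangements (n + 1)) < ν) :
    ∃ a b, 0 < a ∧ 0 < b ∧ asymLaplaceMoment n a b = c ^ n * numDerangements n ∧
      asymLaplaceMoment (n + 1) a b = ν := by
  have hn0 : n ≠ 0 := by omega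
  have hD := numDerangements_pos_of_two_le hn2
  have hcont : ∀ k, Continuous fun θ : ℝ => asymLaplaceMoment k (1 - θ) θ := by
    intro k
    unfold asymLaplaceMoment
    simp only [sub_add_cancel, div_one]
    fun_prop
  have hzero : ∀ k, asymLaplaceMoment k (1 - 0) 0 = numDerangements k := by
    intro k
    rw [sub_zero, asymLaplaceMoment_zero_right k one_ne_zero, one_pow, one_mul]
  have hone : ∀ k, asymLaplaceMoment k (1 - 1) 1 = (-1) ^ k * numDerangements k := by
    intro k
    rw [asymLaplaceMoment_swap, sub_self, asymLaplaceMoment_zero_right k one_ne_zero, one_pow,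
      one_mul]
  have hpos : ∀ θ ∈ Set.Icc (0 : ℝ) 1, 0 < asymLaplaceMoment n (1 - θ) θ := by
    intro θ hθ
    rcases hθ.1.eq_or_lt with h | h
    · rw [← h, hzero]; exact hD
    rcases hθ.2.eq_or_lt with h' | h'
    · rw [h', hone, hn.neg_one_pow, one_mul]; exact hD
    exact asymLaplaceMoment_even_pos (by linarith) h hn
  set s : ℝ → ℝ := fun θ => c * (numDerangements n / asymLaplaceMoment n (1 - θ) θ) ^ ((n : ℝ)⁻¹)
  have hs_cont : ContinuousOn s (Set.Icc 0 1) := by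
    refine continuousOn_const.mul (ContinuousOn.rpow_const ?_ fun θ hθ => Or.inr (by positivity))
    exact continuousOn_const.div (hcont n).continuousOn fun θ hθ => (hpos θ hθ).ne'
  have hs_pos : ∀ θ ∈ Set.Icc (0 : ℝ) 1, 0 < s θ := fun θ hθ =>
    mul_pos hc (Real.rpow_pos_of_pos (div_pos hD (hpos θ hθ)) _)
  have hs_pow : ∀ θ ∈ Set.Icc (0 : ℝ) 1,
      s θ ^ n * asymLaplaceMoment n (1 - θ) θ = c ^ n * numDerangements n := by
    intro θ hθ
    have := hpos θ hθ
    simp only [s]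
    rw [mul_pow, Real.rpow_inv_natCast_pow (div_pos hD this).le hn0]
    field_simp
  have hs0 : s 0 = c := by simp only [s, hzero, div_self hD.ne', Real.one_rpow, mul_one]
  have hs1 : s 1 = c := by
    simp only [s, hone, hn.neg_one_pow, one_mul, div_self hD.ne', Real.one_rpow, mul_one]
  have hG : ContinuousOn (fun θ => s θ ^ (n + 1) * asymLaplaceMoment (n + 1) (1 - θ) θ)
      (Set.Icc 0 1) := (hs_cont.pow _).mul (hcont _).continuousOn
  have hivt := intermediate_value_Icc' (zero_le_one (α := ℝ)) hG
  simp only [hs0, hs1, hzero, hone, hn.add_one.neg_one_pow] at hivt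
  obtain ⟨θ, hθ, hval⟩ := hivt ⟨by linarith, hν.le⟩
  simp only at hval
  have h0 : θ ≠ 0 := by
    rintro rfl
    rw [hs0, hzero] at hval
    exact hν.ne hval.symm
  have h1 : θ ≠ 1 := by
    rintro rfl
    rw [hs1, hone, hn.add_one.neg_one_pow] at hval
    linarith
  have hsp := hs_pos θ hθ
  refine ⟨s θ * (1 - θ), s θ * θ, mul_pos hsp ?_, mul_pos hsp ?_, ?_, ?_⟩
  · have := lt_of_le_of_ne hθ.2 h1; linarith
  · exact lt_of_le_of_ne hθ.1 (Ne.symm h0)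
  · rw [asymLaplaceMoment_mul hsp.ne', hs_pow θ hθ]
  · rw [asymLaplaceMoment_mul hsp.ne', hval]

/-- For a centered log-concave density, either consecutive even moments compare strictly, or the
law is a reflected or unreflected scaled exponential law. -/
lemma IsLogConcavePDF.moment_lt_or {f : ℝ → ℝ} (hf : IsLogConcavePDF f)
    (hf1 : ∫ x, x * f x = 0) {n : ℕ} (hn : Even n) (hn2 : 2 ≤ n) :
    ((∫ x, x ^ (n + 2) * f x) / numDerangements (n + 2)) ^ n <
      ((∫ x, x ^ n * f x) / numDerangements n) ^ (n + 2) ∨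
    (∃ a > 0, volume.withDensity (fun x => ENNReal.ofReal (f x)) =
      volume.withDensity (fun x => ENNReal.ofReal (scaledExpPDF a x))) ∨
    (∃ a > 0, volume.withDensity (fun x => ENNReal.ofReal (f (-x))) =
      volume.withDensity (fun x => ENNReal.ofReal (scaledExpPDF a x))) := by
  have hF := hf.hasMoments
  have hD := numDerangements_pos_of_two_le hn2
  have hD2 := numDerangements_pos_of_two_le (show 2 ≤ n + 2 by omega)
  have hμ := integral_even_pow_mul_pos hF hf.nonneg hf.integral_eq_one hn
  have hμ2 := integral_even_pow_mul_pos hF hf.nonneg hf.integral_eq_one (hn.add even_two)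
  set c : ℝ := ((∫ x, x ^ n * f x) / numDerangements n) ^ ((n : ℝ)⁻¹)
  have hc : 0 < c := Real.rpow_pos_of_pos (div_pos hμ hD) _
  have hcn : ∫ x, x ^ n * f x = c ^ n * numDerangements n := by
    rw [Real.rpow_inv_natCast_pow (div_pos hμ hD).le (by omega)]
    field_simp
  have hr := integral_pow_mul_comp_neg f
  obtain ⟨hle, heq⟩ := hf.odd_moment_le hf1 hn hn2 hc hcn
  have hcn' : ∫ x, x ^ n * f (-x) = c ^ n * numDerangements n := by
    rw [hr, hn.neg_one_pow, one_mul, hcn]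
  have hf1' : ∫ x, x * f (-x) = 0 := by
    have := hr 1
    simpa [hf1] using this
  -- The reflected density provides the lower bound for the odd moment.
  obtain ⟨hle', heq'⟩ := hf.comp_neg.odd_moment_le hf1' hn hn2 hc hcn'
  rw [hr, hn.add_one.neg_one_pow] at hle' heq'
  rcases hle.eq_or_lt with h | h
  · exact Or.inr (Or.inl ⟨c, hc, heq h⟩)
  rcases hle'.eq_or_lt with h' | h'
  · exact Or.inr (Or.inr ⟨c, hc, heq' h'⟩)
  left
  obtain ⟨a, b, ha, hb, e1, e2⟩ := exists_asymLaplaceMoment_eq hn hn2 hc h (by linarith)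
  have h3 := hf.moment_le_asymLaplaceMoment hf1 hn hn2 ha hb (hcn.trans e1.symm) e2.symm
  rw [hcn, ← e1]
  refine lt_of_le_of_lt ?_ (asymLaplaceMoment_pow_lt hn hn2 ha hb)
  gcongr

/-! ### From densities to random variables. -/

lemma map_const_mul_withDensity_ofReal {c : ℝ} (hc : c ≠ 0) {f : ℝ → ℝ} (hf : Measurable f) :
    (volume.withDensity fun x => ENNReal.ofReal (f x)).map (fun x => c * x) =
      volume.withDensity fun y => ENNReal.ofReal (|c⁻¹| * f (y / c)) := by
  ext s hs
  have hm : Measurable fun x : ℝ => c * x := by fun_prop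
  have hF : Measurable fun y => s.indicator (fun y => ENNReal.ofReal (f (y / c))) y :=
    Measurable.indicator (by fun_prop) hs
  rw [Measure.map_apply hm hs, withDensity_apply _ (hm hs), withDensity_apply _ hs,
    ← lintegral_indicator (hm hs)]
  have h1 : ∀ x, ((fun x : ℝ => c * x) ⁻¹' s).indicator (fun x => ENNReal.ofReal (f x)) x =
      s.indicator (fun y => ENNReal.ofReal (f (y / c))) (c * x) := by
    intro x
    by_cases h : c * x ∈ s <;> simp [h, Set.indicator, mul_div_cancel_left₀ _ hc]
  simp_rw [h1]
  rw [← lintegral_map hF hm, Real.map_volume_mul_left hc, lintegral_smul_measure,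
    lintegral_indicator hs, smul_eq_mul, ← lintegral_const_mul _ (by fun_prop)]
  simp_rw [← ENNReal.ofReal_mul (abs_nonneg _)]

lemma centeredExpPDF_eq : centeredExpPDF = scaledExpPDF 1 := by
  funext x
  unfold centeredExpPDF scaledExpPDF expTail
  simp only [div_one]
  by_cases h : -1 ≤ x
  · rw [if_pos h, if_pos (by linarith)]
  · rw [if_neg h, if_neg (by linarith)]

lemma measurable_centeredExpPDF : Measurable centeredExpPDF := by
  unfold centeredExpPDF
  exact Measurable.ite measurableSet_Ici (by fun_prop) measurable_const

lemma map_const_mul_centeredExpLaw {a : ℝ} (ha : 0 < a) :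
    centeredExpLaw.map (fun x => a * x) =
      volume.withDensity fun x => ENNReal.ofReal (scaledExpPDF a x) := by
  rw [centeredExpLaw, map_const_mul_withDensity_ofReal ha.ne' measurable_centeredExpPDF]
  congr 1
  funext x
  congr 1
  rw [centeredExpPDF_eq, abs_of_pos (inv_pos.mpr ha)]
  unfold scaledExpPDF expTail
  have h : x / a + 1 = (x + a) / a := by field_simp
  rw [h, div_one, div_one]
  by_cases hx : 0 ≤ x + a
  · rw [if_pos hx, if_pos (by positivity)]; ring
  · rw [if_neg hx, if_neg (by rw [not_le] at hx ⊢; exact div_neg_of_neg_of_pos hx ha)]; simp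

section Density

variable {Ω : Type*} [MeasurableSpace Ω] {P : Measure Ω} {X : Ω → ℝ} {f : ℝ → ℝ}

lemma integrable_pow_and_integral_pow (hX : AEMeasurable X P) (hf : Measurable f)
    (hf0 : ∀ x, 0 ≤ f x) (hP : P.map X = volume.withDensity fun x => ENNReal.ofReal (f x))
    (hm : HasMoments f) (n : ℕ) :
    Integrable (fun ω => X ω ^ n) P ∧ ∫ ω, X ω ^ n ∂P = ∫ x, x ^ n * f x := by
  have hmeas : Measurable fun x => ENNReal.ofReal (f x) := by fun_prop
  have hlt : ∀ᵐ x ∂(volume : Measure ℝ), ENNReal.ofReal (f x) < ⊤ :=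
    Filter.Eventually.of_forall fun x => ENNReal.ofReal_lt_top
  constructor
  · have h := (integrable_map_measure (f := X) (g := fun x : ℝ => x ^ n) (μ := P)
      (by fun_prop) hX).mp
    refine h ?_
    rw [hP, integrable_withDensity_iff hmeas hlt]
    simpa only [ENNReal.toReal_ofReal (hf0 _)] using hm n
  · rw [← integral_map (f := fun x : ℝ => x ^ n) hX (by fun_prop), hP,
      integral_withDensity_eq_integral_toReal_smul hmeas hlt]
    simp only [ENNReal.toReal_ofReal (hf0 _), smul_eq_mul, mul_comm]

lemma memLp_and_lpNorm_eq (hX : AEMeasurable X P) (hf : Measurable f)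
    (hf0 : ∀ x, 0 ≤ f x) (hP : P.map X = volume.withDensity fun x => ENNReal.ofReal (f x))
    (hm : HasMoments f) {n : ℕ} (hn : Even n) (hn0 : n ≠ 0) :
    MemLp X n P ∧ lpNorm X n P = (∫ x, x ^ n * f x) ^ (1 / (n : ℝ)) := by
  obtain ⟨h1, h2⟩ := integrable_pow_and_integral_pow hX hf hf0 hP hm n
  have e : (fun ω => ‖X ω‖ ^ (n : ENNReal).toReal) = fun ω => X ω ^ n := by
    funext ω
    rw [ENNReal.toReal_natCast, Real.rpow_natCast, Real.norm_eq_abs, hn.pow_abs]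
  have hn0' : (n : ENNReal) ≠ 0 := by exact_mod_cast hn0
  constructor
  · rw [← integrable_norm_rpow_iff hX.aestronglyMeasurable hn0' (by simp), e]
    exact h1
  · rw [lpNorm_eq_integral_norm_rpow_toReal hn0' (by simp) hX.aestronglyMeasurable, e, h2,
      ENNReal.toReal_natCast, one_div]

lemma IsLogConcave.exists_isLogConcavePDF [IsProbabilityMeasure P] (hX : IsLogConcave X P) :
    AEMeasurable X P ∧ ∃ f, IsLogConcavePDF f ∧
      P.map X = volume.withDensity fun x => ENNReal.ofReal (f x) := by
  obtain ⟨hXm, f, hf, hf0, hP, hc⟩ := hX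
  refine ⟨hXm, f, ?_, hP⟩
  have hprob : IsProbabilityMeasure (P.map X) := Measure.isProbabilityMeasure_map hXm
  have h1 : ∫⁻ x, ENNReal.ofReal (f x) = 1 := by
    have := hprob.measure_univ
    rwa [hP, withDensity_apply _ MeasurableSet.univ, Measure.restrict_univ] at this
  have hint : Integrable f := by
    refine ⟨hf.aestronglyMeasurable, ?_⟩
    rw [hasFiniteIntegral_iff_ofReal (Filter.Eventually.of_forall hf0), h1]
    exact ENNReal.one_lt_top
  refine ⟨hf, hf0, hint, ?_, hc⟩
  rw [integral_eq_lintegral_of_nonneg_ae (Filter.Eventually.of_forall hf0)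
    hf.aestronglyMeasurable, h1, ENNReal.toReal_one]

end Density

lemma rpow_one_div_lt_of_pow_lt {A B : ℝ} (hA : 0 ≤ A) (hB : 0 ≤ B) {m n : ℕ} (hm : m ≠ 0)
    (hn : n ≠ 0) (h : B ^ m < A ^ n) : B ^ (1 / (n : ℝ)) < A ^ (1 / (m : ℝ)) := by
  have hm' : (0 : ℝ) < m := by positivity
  have hn' : (0 : ℝ) < n := by positivity
  have h1 := Real.rpow_lt_rpow (by positivity) h
    (show 0 < (1 / ((m : ℝ) * n)) by positivity)
  rw [← Real.rpow_natCast B, ← Real.rpow_natCast A, ← Real.rpow_mul hB, ← Real.rpow_mul hA] at h1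
  convert h1 using 2 <;> field_simp

/-- Unless it is a possibly reflected scaled exponential law, a centered log-concave law has
strictly decreasing normalized even moments. -/
lemma IsLogConcavePDF.normalized_moment_lt_or {f : ℝ → ℝ} (hf : IsLogConcavePDF f)
    (hf1 : ∫ x, x * f x = 0) {p q : ℕ} (hp : Even p) (hp0 : 0 < p) (hq : Even q) (hpq : p < q) :
    ((∫ x, x ^ q * f x) / numDerangements q) ^ (1 / (q : ℝ)) <
      ((∫ x, x ^ p * f x) / numDerangements p) ^ (1 / (p : ℝ)) ∨
    (∃ a > 0, volume.withDensity (fun x => ENNReal.ofReal (f x)) =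
      volume.withDensity (fun x => ENNReal.ofReal (scaledExpPDF a x))) ∨
    (∃ a > 0, volume.withDensity (fun x => ENNReal.ofReal (f (-x))) =
      volume.withDensity (fun x => ENNReal.ofReal (scaledExpPDF a x))) := by
  -- The exceptional alternatives do not depend on `n`, so they can be excluded once for all steps
  -- of the chain from `p` to `q`.
  by_contra! hcon
  obtain ⟨hle, hne, hne'⟩ := hcon
  have hpos : ∀ n : ℕ, Even n → 0 ≤ (∫ x, x ^ n * f x) / numDerangements n := fun n hn =>
    div_nonneg (integral_even_pow_mul_pos hf.hasMoments hf.nonneg hf.integral_eq_one hn).le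
      (Nat.cast_nonneg _)
  have hstep : ∀ n : ℕ, Even n → 2 ≤ n →
      ((∫ x, x ^ (n + 2) * f x) / numDerangements (n + 2)) ^ (1 / ((n + 2 : ℕ) : ℝ)) <
      ((∫ x, x ^ n * f x) / numDerangements n) ^ (1 / (n : ℝ)) := by
    intro n hn hn2
    rcases hf.moment_lt_or hf1 hn hn2 with h | ⟨a, ha, h⟩ | ⟨a, ha, h⟩
    · exact rpow_one_div_lt_of_pow_lt (hpos n hn) (hpos _ (hn.add even_two)) (by omega)
        (by omega) h
    · exact absurd h (hne a ha)
    · exact absurd h (hne' a ha)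
  obtain ⟨i, rfl⟩ := hp.exists_two_nsmul
  obtain ⟨j, rfl⟩ := hq.exists_two_nsmul
  simp only [smul_eq_mul] at *
  have hanti : StrictAntiOn (fun k : ℕ =>
      ((∫ x, x ^ (2 * k) * f x) / numDerangements (2 * k)) ^ (1 / ((2 * k : ℕ) : ℝ)))
      (Set.Ici 1) := by
    refine strictAntiOn_of_succ_lt Set.ordConnected_Ici fun k _ hk _ => ?_
    have hk1 : 1 ≤ k := hk
    exact hstep (2 * k) (even_two_mul k) (by omega)
  exact absurd (hanti (show 1 ≤ i by omega) (show 1 ≤ j by omega) (by omega)) (not_lt.mpr hle)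

theorem theorem15 {Ω Ω' : Type*} [MeasurableSpace Ω] [MeasurableSpace Ω']
    (P : Measure Ω) [IsProbabilityMeasure P] (P' : Measure Ω') [IsProbabilityMeasure P']
    (X : Ω → ℝ) (hX : IsLogConcave X P) (hX0 : ∫ ω, X ω ∂P = 0)
    (Γ : Ω' → ℝ) (hΓ : HasLaw Γ centeredExpLaw P')
    (p q : ℕ) (hp0 : 0 < p) (hp : Even p) (hq : Even q) (hpq : p < q) (hq100 : q < 100) :
    (MemLp X q P ∧ 0 < lpNorm X p P) ∧
    (MemLp Γ q P' ∧ 0 < lpNorm Γ p P') ∧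
    lpNorm X q P / lpNorm X p P ≤ lpNorm Γ q P' / lpNorm Γ p P' ∧
    lpNorm Γ q P' / lpNorm Γ p P' =
      (numDerangements q : ℝ) ^ (1 / (q : ℝ)) / (numDerangements p : ℝ) ^ (1 / (p : ℝ)) ∧
    (lpNorm X q P / lpNorm X p P = lpNorm Γ q P' / lpNorm Γ p P' ↔
      ∃ c : ℝ, c ≠ 0 ∧ IdentDistrib X (fun ω => c * Γ ω) P P') := by
  obtain ⟨hXm, f, hf, hPX⟩ := hX.exists_isLogConcavePDF
  have hF := hf.hasMoments
  have hf1 : ∫ x, x * f x = 0 := by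
    have := (integrable_pow_and_integral_pow hXm hf.measurable hf.nonneg hPX hF 1).2
    simp only [pow_one] at this
    rw [← this, hX0]
  have hΓlaw : P'.map Γ = volume.withDensity fun x => ENNReal.ofReal (centeredExpPDF x) :=
    hΓ.map_eq
  have hG0 : ∀ x, 0 ≤ centeredExpPDF x := by
    rw [centeredExpPDF_eq]; exact scaledExpPDF_nonneg one_pos
  have hG : HasMoments centeredExpPDF := by
    rw [centeredExpPDF_eq]; exact hasMoments_scaledExpPDF one_pos
  have hp2 : 2 ≤ p := by rcases hp with ⟨i, hi⟩; omega
  have hp0' : p ≠ 0 := by omega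
  have hq0' : q ≠ 0 := by omega
  obtain ⟨-, hXp⟩ := memLp_and_lpNorm_eq hXm hf.measurable hf.nonneg hPX hF hp hp0'
  obtain ⟨hXL, hXq⟩ := memLp_and_lpNorm_eq hXm hf.measurable hf.nonneg hPX hF hq hq0'
  obtain ⟨-, hΓp⟩ := memLp_and_lpNorm_eq hΓ.aemeasurable measurable_centeredExpPDF hG0 hΓlaw hG
    hp hp0'
  obtain ⟨hΓL, hΓq⟩ := memLp_and_lpNorm_eq hΓ.aemeasurable measurable_centeredExpPDF hG0 hΓlaw hG
    hq hq0'
  simp only [centeredExpPDF_eq, integral_pow_mul_scaledExpPDF one_pos, one_pow, one_mul]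
    at hΓp hΓq
  have hDp := numDerangements_pos_of_two_le hp2
  have hDq := numDerangements_pos_of_two_le (show 2 ≤ q by omega)
  have hμp := integral_even_pow_mul_pos hF hf.nonneg hf.integral_eq_one hp
  have hμq := integral_even_pow_mul_pos hF hf.nonneg hf.integral_eq_one hq
  -- Serves twice: as one direction of the equality case, and for the inequality when the law is
  -- exponential.
  have hident : ∀ c : ℝ, c ≠ 0 → IdentDistrib X (fun ω => c * Γ ω) P P' →
      lpNorm X q P / lpNorm X p P = lpNorm Γ q P' / lpNorm Γ p P' := by
    intro c hc hid
    have h : ∀ r : ENNReal, lpNorm X r P = |c| * lpNorm Γ r P' := by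
      intro r
      have h1 : lpNorm X r P = lpNorm (c • Γ) r P' := by
        rw [← toReal_eLpNorm hXm.aestronglyMeasurable,
          ← toReal_eLpNorm (hΓ.aemeasurable.const_smul c).aestronglyMeasurable, hid.eLpNorm_eq r]
        rfl
      rw [h1, lpNorm_const_smul]
      simp
    rw [h, h, mul_div_mul_left _ _ (abs_ne_zero.mpr hc)]
  have hscale : ∀ a > 0, P'.map (fun ω => a * Γ ω) =
      volume.withDensity fun x => ENNReal.ofReal (scaledExpPDF a x) := by
    intro a ha
    rw [← map_const_mul_centeredExpLaw ha, ← hΓ.map_eq,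
      AEMeasurable.map_map_of_aemeasurable (by fun_prop) hΓ.aemeasurable]
    rfl
  have hcases : lpNorm X q P / lpNorm X p P < lpNorm Γ q P' / lpNorm Γ p P' ∨
      ∃ c : ℝ, c ≠ 0 ∧ IdentDistrib X (fun ω => c * Γ ω) P P' := by
    rcases hf.normalized_moment_lt_or hf1 hp hp0 hq hpq with h | ⟨a, ha, h⟩ | ⟨a, ha, h⟩
    · left
      rw [hXp, hXq, hΓp, hΓq, div_lt_div_iff₀ (by positivity) (by positivity)]
      rw [Real.div_rpow hμq.le hDq.le, Real.div_rpow hμp.le hDp.le,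
        div_lt_div_iff₀ (by positivity) (by positivity)] at h
      linarith
    · exact Or.inr ⟨a, ha.ne', hXm, hΓ.aemeasurable.const_mul a,
        (hPX.trans h).trans (hscale a ha).symm⟩
    -- When the reflected density is exponential, `-X` has the law of `a * Γ`; composing with
    -- negation gives the factor `-a`.
    · have hneg : P.map (fun ω => -1 * X ω) = P'.map (fun ω => a * Γ ω) := by
        rw [hscale a ha, ← h]
        have h1 := map_const_mul_withDensity_ofReal (c := -1) (by norm_num) hf.measurable
        rw [← hPX, AEMeasurable.map_map_of_aemeasurable (by fun_prop) hXm] at h1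
        refine Eq.trans h1 ?_
        norm_num [div_neg]
      have hid : IdentDistrib (fun ω => -1 * X ω) (fun ω => a * Γ ω) P P' :=
        ⟨hXm.const_mul _, hΓ.aemeasurable.const_mul a, hneg⟩
      refine Or.inr ⟨-a, neg_ne_zero.mpr ha.ne', ?_⟩
      have h2 := hid.comp (u := fun x : ℝ => -1 * x) (by fun_prop)
      convert h2 using 1
      · funext ω; simp
      · funext ω; simp
  refine ⟨⟨hXL, ?_⟩, ⟨hΓL, ?_⟩, ?_, ?_, ?_, ?_⟩
  · rw [hXp]; positivity
  · rw [hΓp]; positivity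
  · rcases hcases with h | ⟨c, hc, hid⟩
    · exact h.le
    · exact (hident c hc hid).le
  · rw [hΓp, hΓq]
  · intro heq
    rcases hcases with h | h
    · exact absurd heq h.ne
    · exact h
  · rintro ⟨c, hc, hid⟩
    exact hident c hc hid
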